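/- Let $p\ge 3$ be a prime and let $e=(e_1,\dots,e_{p-1})\in\mathbb F_p^{\,p-1}$ be non-symmetric, i.e. $e_i\neq e_{p-i}$ for some $1\le i\le p-1$. Let $T$ be the $p$-adic rooted tree, whose vertices are the words over an alphabet of $p$ letters. For $g\in\operatorname{Aut}T$ write $g_u$ for the section of $g$ at the vertex $u$, so that $g(uw)=g(u)g_u(w)$ for all words $w$. Let $G\le\operatorname{Aut}T$ be the GGS-group defined by $e$: the group generated by the rooted automorphism $a$, which permutes the $p$ subtrees below the root cyclically by the permutation $(1\,2\cdots p)$, and by the automorphism $b$, which fixes the first level and is defined recursively by its first level sections $b=(b,a^{e_1},\dots,a^{e_{p-1}})$. Then $G$ is contracting: it contains all sections of its elements, and there is a finite set $\mathcal M\subseteq G$ such that for every $g\in G$ there is a level $n$ such that all sections of $g$ at the vertices at and below level $n$ lie in $\mathcal M$. Let $\mathcal N$ be its nucleus, i.e. the smallest such set. The nucleus portrait of $g\in G$ is the single leaf decorated by $g$ if $g\in\mathcal N$; otherwise it is the tree whose root is decorated by the permutation that $g$ induces on the first level and has the nucleus portraits of the first level sections of $g$ attached below it. Let $d(g)$ be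 the depth of this finite tree, and let $a_n=|\{g\in G : d(g)\le n\}|$ be the portrait growth sequence of $G$. Then $$a_0=1+2(p-1),\qquad a_n=p\,\bigl(x_1+(p-1)y_1\bigr)^{p^{n-1}}\quad\text{for all } n\ge 1,$$ where $x_1$ and $y_1$ are the numbers of solutions $(n_0,\dots,n_{p-1})\in\mathbb F_p^{\,p}$ of $$\bigl((n_0,\dots,n_{p-1})\,C(0,e)\bigr)\odot(n_0,\dots,n_{p-1})=(0,\dots,0)$$ with $n_0+\dots+n_{p-1}=0$ and $n_0+\dots+n_{p-1}=1$, respectively. Here $\odot$ is the coordinatewise product and $C(0,e)$ is the circulant matrix with first row $(0,e_1,\dots,e_{p-1})$, each further row being the previous one shifted cyclically one step to the right. -/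

import Mathlib

namespace GGS

/-! ### Automorphisms of a regular rooted tree, their sections and root permutations -/

/-- The regular rooted tree on the alphabet `X`: its vertices are the words over `X`, the root is
the empty word, and `v` is a child of `u` when `v = ux` for a letter `x`. -/
def IsChild {X : Type*} (u v : List X) : Prop := ∃ x : X, v = u ++ [x]

/-- The group `Aut T` of automorphisms of the rooted tree on `X`, under composition. -/
abbrev TreeAut (X : Type*) : Type _ := (IsChild (X := X)) ≃r (IsChild (X := X))

theorem TreeAut.map_append_singleton {X : Type*} (g : TreeAut X) (u : List X) (x : X) :
    ∃ y, g (u ++ [x]) = g u ++ [y] := g.map_rel_iff.2 ⟨x, rfl⟩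

theorem TreeAut.map_nil {X : Type*} (g : TreeAut X) : g [] = [] := by
  rcases List.eq_nil_or_concat (g []) with h | ⟨v, y, h⟩
  · exact h
  · exfalso
    have h1 : IsChild (g (g.symm v)) (g []) := by
      rw [RelIso.apply_symm_apply, h]; exact ⟨y, by simp⟩
    obtain ⟨x, hx⟩ := g.map_rel_iff.1 h1
    simp at hx

theorem TreeAut.map_append {X : Type*} (g : TreeAut X) (u w : List X) :
    ∃ w', w'.length = w.length ∧ g (u ++ w) = g u ++ w' := by
  induction w using List.reverseRecOn with
  | nil => exact ⟨[], rfl, by simp⟩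
  | append_singleton w x ih =>
    obtain ⟨w', hl, hw⟩ := ih
    obtain ⟨y, hy⟩ := g.map_append_singleton (u ++ w) x
    refine ⟨w' ++ [y], by simp [hl], ?_⟩
    rw [← List.append_assoc, hy, hw, List.append_assoc]

theorem TreeAut.length_map {X : Type*} (g : TreeAut X) (u : List X) :
    (g u).length = u.length := by
  obtain ⟨w', hl, hw⟩ := g.map_append [] u
  simp only [List.nil_append, g.map_nil] at hw
  rw [hw, hl]

theorem TreeAut.append_drop {X : Type*} (g : TreeAut X) (u w : List X) :
    g u ++ (g (u ++ w)).drop u.length = g (u ++ w) := by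
  obtain ⟨w', -, hw⟩ := g.map_append u w
  rw [hw, ← g.length_map u, List.drop_left]

/-- The section `g_u` of `g` at the vertex `u`: the automorphism with
`g (u w) = g (u) g_u (w)` for all words `w`. -/
def TreeAut.sect {X : Type*} (g : TreeAut X) (u : List X) : TreeAut X where
  toFun w := (g (u ++ w)).drop u.length
  invFun w := (g.symm (g u ++ w)).drop u.length
  left_inv w := by
    simp only [g.append_drop, RelIso.symm_apply_apply, List.drop_left]
  right_inv w := by
    have h := TreeAut.append_drop g.symm (g u) w
    rw [g.length_map, RelIso.symm_apply_apply] at h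
    simp only [h, RelIso.apply_symm_apply]
    rw [← g.length_map u, List.drop_left]
  map_rel_iff' := by
    intro v w
    have h : ∀ w, g u ++ (g (u ++ w)).drop u.length = g (u ++ w) := g.append_drop u
    simp only [Equiv.coe_fn_mk]
    have key : ∀ (t v w : List X), IsChild (t ++ v) (t ++ w) ↔ IsChild v w := by
      intro t v w
      simp only [IsChild, List.append_assoc, List.append_cancel_left_eq]
    rw [← key (g u), h, h, g.map_rel_iff, key]

theorem TreeAut.append_sect {X : Type*} (g : TreeAut X) (u w : List X) :
    g (u ++ w) = g u ++ g.sect u w := (g.append_drop u w).symm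

theorem TreeAut.map_singleton_ne_nil {X : Type*} (g : TreeAut X) (x : X) : g [x] ≠ [] := by
  intro h
  have := g.length_map [x]
  simp [h] at this

theorem TreeAut.map_singleton {X : Type*} (g : TreeAut X) (x : X) :
    [(g [x]).head (g.map_singleton_ne_nil x)] = g [x] := by
  obtain ⟨y, hy⟩ := List.length_eq_one_iff.1 (g.length_map [x])
  simp [hy]

/-- The permutation `α` of the first level in the decomposition `g = (g_1, …, g_d) α`. -/
def TreeAut.rootPerm {X : Type*} (g : TreeAut X) : Equiv.Perm X where
  toFun x := (g [x]).head (g.map_singleton_ne_nil x)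
  invFun x := (g.symm [x]).head (TreeAut.map_singleton_ne_nil g.symm x)
  left_inv x := by
    have h := TreeAut.map_singleton g.symm ((g [x]).head (g.map_singleton_ne_nil x))
    apply List.singleton_injective
    exact h.trans (by rw [g.map_singleton, RelIso.symm_apply_apply])
  right_inv x := by
    have h := TreeAut.map_singleton g
      ((g.symm [x]).head (TreeAut.map_singleton_ne_nil g.symm x))
    apply List.singleton_injective
    exact h.trans (by rw [TreeAut.map_singleton g.symm, RelIso.apply_symm_apply])

/-! ### Contracting groups and the nucleus -/

/-- A group of tree automorphisms is self-similar if the sections of its elements belong to it. -/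
def IsSelfSimilar {X : Type*} (G : Subgroup (TreeAut X)) : Prop :=
  ∀ g ∈ G, ∀ u : List X, g.sect u ∈ G

/-- `M` is a finite set of elements of `G` such that for every `g ∈ G` there is a level `n` such
that all sections of `g` at the vertices at and below level `n` belong to `M`. -/
def IsAbsorbing {X : Type*} (G : Subgroup (TreeAut X)) (M : Set (TreeAut X)) : Prop :=
  M.Finite ∧ M ⊆ (G : Set (TreeAut X)) ∧
    ∀ g ∈ G, ∃ n : ℕ, ∀ u : List X, n ≤ u.length → g.sect u ∈ M

/-- Contracting groups. -/
def IsContracting {X : Type*} (G : Subgroup (TreeAut X)) : Prop :=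
  IsSelfSimilar G ∧ ∃ M, IsAbsorbing G M

/-- The nucleus of `G`, the smallest finite set as in `IsAbsorbing`
(see `isLeast_nucleus`). -/
def nucleus {X : Type*} (G : Subgroup (TreeAut X)) : Set (TreeAut X) :=
  ⋂₀ {M | IsAbsorbing G M}

theorem isLeast_nucleus {X : Type*} (G : Subgroup (TreeAut X)) (hG : IsContracting G) :
    IsLeast {M | IsAbsorbing G M} (nucleus G) := by
  obtain ⟨M, hM⟩ := hG.2
  have inter : ∀ A B, IsAbsorbing G A → IsAbsorbing G B → IsAbsorbing G (A ∩ B) := by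
    rintro A B ⟨hA1, hA2, hA3⟩ ⟨-, -, hB3⟩
    refine ⟨hA1.subset Set.inter_subset_left, Set.inter_subset_left.trans hA2, fun g hg => ?_⟩
    obtain ⟨m, hm⟩ := hA3 g hg
    obtain ⟨n, hn⟩ := hB3 g hg
    exact ⟨max m n, fun u hu => ⟨hm u (le_trans (le_max_left _ _) hu),
      hn u (le_trans (le_max_right _ _) hu)⟩⟩
  have hfin : {A | IsAbsorbing G A ∧ A ⊆ M}.Finite :=
    hM.1.finite_subsets.subset fun A hA => hA.2
  obtain ⟨A, hA⟩ := hfin.exists_minimal ⟨M, hM, subset_rfl⟩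
  have hle : ∀ B, IsAbsorbing G B → A ⊆ B := fun B hB =>
    (hA.2 ⟨inter A B hA.1.1 hB, Set.inter_subset_left.trans hA.1.2⟩
      Set.inter_subset_left).trans Set.inter_subset_right
  have hEq : nucleus G = A :=
    Set.Subset.antisymm (Set.sInter_subset_of_mem hA.1.1) (Set.subset_sInter hle)
  rw [hEq]
  exact ⟨hA.1.1, hle⟩

/-! ### Nucleus portraits and portrait growth -/

/-- Finite `X`-ary trees with interior vertices decorated by permutations of `X` and leaves
decorated by tree automorphisms. -/
inductive Portrait (X : Type) : Type
  | leaf (g : TreeAut X) : Portrait X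
  | node (α : Equiv.Perm X) (c : X → Portrait X) : Portrait X

/-- The depth of a decorated tree: the length of a longest path from the root to a leaf. -/
def Portrait.depth {X : Type} [Fintype X] : Portrait X → ℕ
  | .leaf _ => 0
  | .node _ c => (Finset.univ.sup fun x => (c x).depth) + 1

/-- `IsPortrait N g P`: `P` is the portrait of `g` relative to the set `N`. If `g ∈ N`, it is a
single leaf decorated by `g`; otherwise its root is decorated by the root permutation of `g` and
the portraits of the first level sections of `g` are attached below it. -/
inductive IsPortrait {X : Type} (N : Set (TreeAut X)) : TreeAut X → Portrait X → Prop
  | leaf (g : TreeAut X) (hg : g ∈ N) : IsPortrait N g (.leaf g)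
  | node (g : TreeAut X) (hg : g ∉ N) (c : X → Portrait X)
      (hc : ∀ x, IsPortrait N (g.sect [x]) (c x)) : IsPortrait N g (.node g.rootPerm c)

/-- The portrait growth sequence of `G` with respect to the nucleus: `portraitGrowth G n` is the
number of elements of `G` with nucleus portrait of depth at most `n`. -/
noncomputable def portraitGrowth {X : Type} [Fintype X] (G : Subgroup (TreeAut X)) (n : ℕ) : ℕ :=
  Nat.card {g : TreeAut X // g ∈ G ∧ ∃ P, IsPortrait (nucleus G) g P ∧ P.depth ≤ n}

/-! ### GGS-groups. The `p` letters are labelled by the residues `0, 1, …, p - 1` modulo `p`. -/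

/-- The vector `(0, e_1, …, e_{p-1})`; the entry `e_i` is `e ⟨i - 1, _⟩`. -/
def zeroCons {p : ℕ} [NeZero p] (e : Fin (p - 1) → ZMod p) (i : ZMod p) : ZMod p :=
  if h : i = 0 then 0 else
    e ⟨i.val - 1, by
      have h1 : i.val ≠ 0 := fun h0 => h ((ZMod.val_eq_zero i).1 h0)
      have h2 := ZMod.val_lt i
      omega⟩

/-- The vector `e` is symmetric if `e_i = e_{p-i}` for `i = 1, …, p - 1`. -/
def IsSymmetric {p : ℕ} (e : Fin (p - 1) → ZMod p) : Prop :=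
  ∀ i : Fin (p - 1), e i = e i.rev

/-- The action of the rooted automorphism that moves the first letter by `k`. -/
def shift {p : ℕ} (k : ZMod p) : List (ZMod p) → List (ZMod p)
  | [] => []
  | x :: w => (x + k) :: w

/-- The rooted automorphism `a`, permuting the first level subtrees cyclically. -/
def rootedAut (p : ℕ) : TreeAut (ZMod p) where
  toFun := shift 1
  invFun := shift (-1)
  left_inv w := by cases w <;> simp [shift]
  right_inv w := by cases w <;> simp [shift]
  map_rel_iff' := by
    intro u v
    simp only [Equiv.coe_fn_mk, IsChild]
    rcases u with _ | ⟨x, u⟩ <;> rcases v with _ | ⟨y, v⟩ <;> simp [shift]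

/-- The action of `b = (b, a^{e_1}, …, a^{e_{p-1}})`. -/
def dirFun {p : ℕ} [NeZero p] (e : Fin (p - 1) → ZMod p) : List (ZMod p) → List (ZMod p)
  | [] => []
  | x :: w => x :: if x = 0 then dirFun e w else (rootedAut p ^ (zeroCons e x).val) w

/-- The action of `b⁻¹ = (b⁻¹, a^{-e_1}, …, a^{-e_{p-1}})`. -/
def dirInv {p : ℕ} [NeZero p] (e : Fin (p - 1) → ZMod p) : List (ZMod p) → List (ZMod p)
  | [] => []
  | x :: w => x :: if x = 0 then dirInv e w else (rootedAut p ^ (zeroCons e x).val)⁻¹ w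

/-- The automorphism `b`, which fixes the first level and satisfies
`b = (b, a^{e_1}, …, a^{e_{p-1}})`. -/
def directedAut {p : ℕ} [NeZero p] (e : Fin (p - 1) → ZMod p) : TreeAut (ZMod p) where
  toFun := dirFun e
  invFun := dirInv e
  left_inv w := by
    induction w with
    | nil => rfl
    | cons x w ih => by_cases hx : x = 0 <;> simp [dirFun, dirInv, hx, ih]
  right_inv w := by
    induction w with
    | nil => rfl
    | cons x w ih => by_cases hx : x = 0 <;> simp [dirFun, dirInv, hx, ih]
  map_rel_iff' := by
    intro u v
    simp only [Equiv.coe_fn_mk]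
    have key : ∀ (x y : ZMod p) (s t : List (ZMod p)),
        IsChild (x :: s) (y :: t) ↔ x = y ∧ IsChild s t := by
      intro x y s t
      simp only [IsChild, List.cons_append, List.cons.injEq]
      exact ⟨fun ⟨z, h, h'⟩ => ⟨h.symm, z, h'⟩, fun ⟨h, z, h'⟩ => ⟨z, h.symm, h'⟩⟩
    have hlen : ∀ t, dirFun e t = [] ↔ t = [] := by
      intro t; cases t <;> simp [dirFun]
    induction u generalizing v with
    | nil =>
      rcases v with _ | ⟨y, v⟩
      · simp [IsChild, dirFun]
      · by_cases hy : y = 0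
        · simp [IsChild, dirFun, hy, hlen]
        · have h : (rootedAut p ^ (zeroCons e y).val) v = [] ↔ v = [] := by
            rw [← List.length_eq_zero_iff, TreeAut.length_map, List.length_eq_zero_iff]
          simp [IsChild, dirFun, hy, h]
    | cons x u ih =>
      rcases v with _ | ⟨y, v⟩
      · simp [IsChild, dirFun]
      · simp only [dirFun, key]
        apply and_congr_right
        rintro rfl
        by_cases hx : x = 0
        · simp [hx, ih]
        · simp only [hx, if_false]
          exact (rootedAut p ^ (zeroCons e x).val).map_rel_iff

/-- The GGS-group defined by `e`, generated by `a` and `b`. -/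
def ggsGroup {p : ℕ} [NeZero p] (e : Fin (p - 1) → ZMod p) : Subgroup (TreeAut (ZMod p)) :=
  Subgroup.closure {rootedAut p, directedAut e}

/-- The circulant matrix `C(0, e)`: its first row is `(0, e_1, …, e_{p-1})`, and each further row
is the previous one shifted cyclically one step to the right. -/
def circulantMatrix {p : ℕ} [NeZero p] (e : Fin (p - 1) → ZMod p) :
    Matrix (ZMod p) (ZMod p) (ZMod p) :=
  Matrix.of fun k r => zeroCons e (r - k)

/-- The number of `n = (n_0, …, n_{p-1})` over `F_p` with `(n C(0, e)) ⊙ n = 0` and coordinate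
sum `s`. -/
noncomputable def solutionCount {p : ℕ} [NeZero p] (e : Fin (p - 1) → ZMod p) (s : ZMod p) : ℕ :=
  Nat.card {n : ZMod p → ZMod p //
    Matrix.vecMul n (circulantMatrix e) * n = 0 ∧ ∑ i, n i = s}

end GGS

namespace GGS

open scoped commutatorElement

/-! ### Powers with exponents modulo `p` -/

section ModularPowers

variable {H : Type*} [Group H] {p : ℕ}

/-! Write c = (0, e_1, …, e_{p-1}). For g in G let `rot g` be its rotation of the first level and
β(g) its total exponent in b. Each factor b in a word for g contributes b to one section and the
matching powers of a to the others, so rot(g_x) = ∑_j β(g_j) c(x - j) for every x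
(`IsDirectedExponent.rot_sect`). The crux is the converse (`exists_sect_eq`): every tuple in G
satisfying this linear relation is the tuple of first level sections of an element fixing the first
level.

For the converse, let R be the subgroup of those g for which (g, 1, …, 1) lies in G. Whether a tuple
is realized depends only on the classes of its entries modulo R. If G/R is abelian, the class of g
is a^(rot g) b^(β g), and products of powers of the conjugates of b realize every admissible tuple
of classes. Commutativity of G/R is where non-symmetry enters (`IsDirectedSystem.commute`):
commutators of two conjugates of b have at most two nontrivial sections, and combining them leaves
only one, which then lies in R.

The nucleus consists of the powers of a and of b (`nucleus_ggsGroup`). For n ≥ 1, being of depth at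
most n is invariant under left multiplication by a, which gives the factor p and reduces the count
to elements fixing the first level. Such an element of depth at most n + 1 is determined by its
sections up to left powers of a, which can be prescribed freely; the relation fixes the powers.
Hence the p-th powers (`card_stabBall_succ_succ`). At depth 1 the sections are a^k b^l with kl = 0.
They are determined by the vector n of b-exponents, and the condition becomes (nC) ⊙ n = 0
(`card_stabBall_one`). This equation is homogeneous, so all nonzero coordinate sums are equally
frequent. -/

theorem pow_val_add [NeZero p] {g : H} (hg : g ^ p = 1) (k l : ZMod p) :
    g ^ (k + l).val = g ^ k.val * g ^ l.val := by
  rw [ZMod.val_add, ← pow_add, ← pow_eq_pow_mod _ hg]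

theorem pow_val_mul {g : H} (hg : g ^ p = 1) (k l : ZMod p) :
    g ^ (k * l).val = (g ^ k.val) ^ l.val := by
  rw [ZMod.val_mul, ← pow_mul, ← pow_eq_pow_mod _ hg]

theorem pow_val_neg [NeZero p] {g : H} (hg : g ^ p = 1) (k : ZMod p) :
    g ^ (-k).val = (g ^ k.val)⁻¹ := by
  rw [eq_inv_iff_mul_eq_one, ← pow_val_add hg, neg_add_cancel, ZMod.val_zero, pow_zero]

theorem pow_val_one [Fact p.Prime] (g : H) : g ^ (1 : ZMod p).val = g := by
  rw [ZMod.val_one, pow_one]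

theorem pow_val_zero (g : H) : g ^ (0 : ZMod p).val = 1 := by
  rw [ZMod.val_zero, pow_zero]

theorem eq_pow_val_inv [Fact p.Prime] {g : H} (hg : g ^ p = 1) {k : ZMod p} (hk : k ≠ 0) :
    g = (g ^ k.val) ^ (k⁻¹).val := by
  rw [← pow_val_mul hg, mul_inv_cancel₀ hk, pow_val_one]

theorem commutator_pow_right {x y : H} (hy : Commute ⁅x, y⁆ y) (n : ℕ) :
    ⁅x, y ^ n⁆ = ⁅x, y⁆ ^ n := by
  have h : x * y * x⁻¹ = ⁅x, y⁆ * y := by simp [commutatorElement_def]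
  have h2 : x * y ^ n * x⁻¹ = ⁅x, y⁆ ^ n * y ^ n := by
    rw [← conj_pow, h, hy.mul_pow]
  rw [commutatorElement_def, h2, mul_inv_cancel_right]

end ModularPowers

/-! ### A commutation criterion -/

theorem eq_neg_of_ne_zmod_three : ∀ u v : ZMod 3, u ≠ v → u ≠ 0 → v ≠ 0 → v = -u := by decide


/-- A group `S` with homomorphisms `q x`, one for each residue `x`, to a group `Q`, together with
elements `β j` whose images are the cyclic shifts of `(B, A ^ c 1, …, A ^ c (p - 1))`, such that
no element of `S` has exactly one nontrivial image. -/
structure IsDirectedSystem {p : ℕ} {S Q : Type*} [Group S] [Group Q] (q : ZMod p → S →* Q)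
    (β : ZMod p → S) (A B : Q) (c : ZMod p → ZMod p) : Prop where
  zero : c 0 = 0
  pow_left : A ^ p = 1
  pow_right : B ^ p = 1
  map_self : ∀ j, q j (β j) = B
  map_other : ∀ x j, x ≠ j → q x (β j) = A ^ (c (x - j)).val
  eq_one : ∀ y h, (∀ x, x ≠ y → q x h = 1) → q y h = 1

namespace IsDirectedSystem

variable {p : ℕ} {S Q : Type*} [Group S] [Group Q] {q : ZMod p → S →* Q}
  {β : ZMod p → S} {A B : Q} {c : ZMod p → ZMod p}

/-- The commutator of `h` and `k` has trivial image away from `y`, hence also at `y`. -/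
theorem commute_map (D : IsDirectedSystem q β A B c) (y : ZMod p) (h k : S)
    (hk : ∀ x, x ≠ y → q x h = 1 ∨ q x k = 1) : Commute (q y h) (q y k) := by
  rw [← commutatorElement_eq_one_iff_commute, ← map_commutatorElement]
  refine D.eq_one y _ fun x hx => ?_
  rw [map_commutatorElement]
  rcases hk x hx with h | h <;> simp [h]

variable [Fact p.Prime]

theorem map_commutator_left (D : IsDirectedSystem q β A B c) {i : ZMod p} (hi : i ≠ 0)
    (j : ZMod p) : q j ⁅β j, β (j + i)⁆ = ⁅B, A ^ (c (-i)).val⁆ := by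
  rw [map_commutatorElement, D.map_self, D.map_other _ _ (by simpa using hi)]
  simp

theorem map_commutator_right (D : IsDirectedSystem q β A B c) {i : ZMod p} (hi : i ≠ 0)
    (j : ZMod p) : q (j + i) ⁅β j, β (j + i)⁆ = ⁅A ^ (c i).val, B⁆ := by
  rw [map_commutatorElement, D.map_self, D.map_other _ _ (by simpa using hi)]
  simp

theorem map_commutator_other (D : IsDirectedSystem q β A B c) {i j x : ZMod p}
    (h1 : x ≠ j) (h2 : x ≠ j + i) : q x ⁅β j, β (j + i)⁆ = 1 := by
  rw [map_commutatorElement, D.map_other _ _ h1, D.map_other _ _ h2,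
    commutatorElement_eq_one_iff_commute]
  exact (Commute.refl A).pow_pow _ _

theorem commute_of_commute_pow (D : IsDirectedSystem q β A B c) {x : Q} {k : ZMod p}
    (hk : k ≠ 0) (h : Commute x (A ^ k.val)) : Commute x A := by
  rw [eq_pow_val_inv D.pow_left hk]
  exact h.pow_right _

/-- The commutator `⁅β 0, β i⁆` commutes in its image at `0` with everything that has trivial
image at `i`. -/
theorem commute_commutator (D : IsDirectedSystem q β A B c) {i : ZMod p} (hi : i ≠ 0) (k : S)
    (hk : q i k = 1) : Commute ⁅B, A ^ (c (-i)).val⁆ (q 0 k) := by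
  have h := D.map_commutator_left hi 0
  rw [zero_add] at h
  rw [← h]
  refine D.commute_map 0 _ k fun x hx => ?_
  by_cases hxi : x = i
  · exact Or.inr (hxi ▸ hk)
  · have := D.map_commutator_other (i := i) hx (by simpa using hxi)
    rw [zero_add] at this
    exact Or.inl this

theorem map_pow_mul_pow (D : IsDirectedSystem q β A B c) {x k l : ZMod p} (hk : x ≠ k)
    (hl : x ≠ l) (s t : ZMod p) :
    q x (β k ^ s.val * β l ^ t.val) = A ^ (c (x - k) * s + c (x - l) * t).val := by
  rw [map_mul, map_pow, map_pow, D.map_other _ _ hk, D.map_other _ _ hl, pow_val_add D.pow_left,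
    pow_val_mul D.pow_left, pow_val_mul D.pow_left]

/-- When c i = 0, the commutator of β 0 and β i also dies at i, so only its image at 0 could
survive. -/
theorem commute_of_eq_zero (D : IsDirectedSystem q β A B c) {i : ZMod p} (h0 : c i = 0)
    (h1 : c (-i) ≠ 0) : Commute B A := by
  have hi : i ≠ 0 := by rintro rfl; exact h1 (by simpa using h0)
  refine D.commute_of_commute_pow h1 ?_
  rw [← commutatorElement_eq_one_iff_commute]
  have h := D.map_commutator_left hi 0
  rw [← h]
  refine D.eq_one 0 _ fun x hx => ?_
  by_cases hxi : x = 0 + i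
  · rw [hxi, D.map_commutator_right hi, h0]
    simp
  · exact D.map_commutator_other hx hxi

/-- Independence of two columns of exponents makes a commutator commute with `A`. -/
theorem commute_commutator_of_det_ne_zero (D : IsDirectedSystem q β A B c) {i k l : ZMod p}
    (hi : i ≠ 0) (hk0 : k ≠ 0) (hki : k ≠ i) (hl0 : l ≠ 0) (hli : l ≠ i)
    (hdet : c (i - k) * c (-l) - c (i - l) * c (-k) ≠ 0) :
    Commute ⁅B, A ^ (c (-i)).val⁆ A := by
  set d := c (i - k) * c (-l) - c (i - l) * c (-k) with hd
  -- The exponents solve a 2 × 2 system by Cramer's rule: this product of powers of β k and β l has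
  -- image 1 at i and A at 0.
  have h1 := D.map_pow_mul_pow hki.symm hli.symm (-c (i - l) * d⁻¹) (c (i - k) * d⁻¹)
  have h2 := D.map_pow_mul_pow hk0.symm hl0.symm (-c (i - l) * d⁻¹) (c (i - k) * d⁻¹)
  have e1 : c (i - k) * (-c (i - l) * d⁻¹) + c (i - l) * (c (i - k) * d⁻¹) = 0 := by ring
  have e2 : c (0 - k) * (-c (i - l) * d⁻¹) + c (0 - l) * (c (i - k) * d⁻¹) = 1 := by
    rw [zero_sub, zero_sub, ← mul_inv_cancel₀ hdet, hd]; ring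
  rw [e1, pow_val_zero] at h1
  rw [e2, pow_val_one] at h2
  exact h2 ▸ D.commute_commutator hi _ h1

/-- If a commutator `⁅B, A ^ k⁆` commutes with `A` and `c` is not symmetric then it is trivial. -/
theorem commute_of_commute_commutator (D : IsDirectedSystem q β A B c) {k : ZMod p} (hk : k ≠ 0)
    (hA : Commute ⁅B, A ^ k.val⁆ A) {i : ZMod p}
    (hi : c i ≠ c (-i)) : Commute B A := by
  have hi0 : i ≠ 0 := by rintro rfl; simp at hi
  set Y := ⁅B, A⁆ with hY
  have hYk : Y = ⁅B, A ^ k.val⁆ ^ (k⁻¹).val := by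
    rw [← commutator_pow_right (hA.pow_right _), ← eq_pow_val_inv D.pow_left hk]
  have hYA : Commute Y A := hYk ▸ hA.pow_left _
  have hYp : Y ^ p = 1 := by
    rw [← commutator_pow_right hYA, D.pow_left, commutatorElement_one_right]
  have hcomm : ∀ n : ZMod p, ⁅B, A ^ n.val⁆ = Y ^ n.val := fun n => commutator_pow_right hYA _
  -- `K f` says that the tuple of powers of Y with exponent vector f is realized in S. These vectors
  -- are closed under sums and scalars, so it suffices to find one supported at 0 alone.
  let K : (ZMod p → ZMod p) → Prop := fun f => ∃ h : S, ∀ x, q x h = Y ^ (f x).val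
  have K_add : ∀ f g, K f → K g → K (f + g) := by
    rintro f g ⟨h, hh⟩ ⟨h', hh'⟩
    exact ⟨h * h', fun x => by rw [map_mul, hh, hh', Pi.add_apply, pow_val_add hYp]⟩
  have K_smul : ∀ (n : ZMod p) f, K f → K (n • f) := by
    rintro n f ⟨h, hh⟩
    exact ⟨h ^ n.val, fun x => by
      rw [map_pow, hh, Pi.smul_apply, smul_eq_mul, mul_comm, pow_val_mul hYp]⟩
  have K_gen : ∀ j, K (c (-i) • Pi.single j 1 - c i • Pi.single (j + i) 1) := by
    intro j
    refine ⟨⁅β j, β (j + i)⁆, fun x => ?_⟩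
    by_cases h1 : x = j
    · subst h1
      rw [D.map_commutator_left hi0, hcomm]
      simp [hi0]
    by_cases h2 : x = j + i
    · subst h2
      rw [D.map_commutator_right hi0, ← commutatorElement_inv, hcomm, ← pow_val_neg hYp]
      simp [hi0]
    · rw [D.map_commutator_other h1 h2]
      simp [h1, h2]
  -- The relations `K_gen` telescope along 0, i, 2i, …
  have K_pow : ∀ n : ℕ, K (c (-i) ^ n • Pi.single 0 1 - c i ^ n • Pi.single (n * i) 1) := by
    intro n
    induction n with
    | zero => exact ⟨1, fun x => by simp⟩
    | succ n ih =>
      have := K_add _ _ (K_smul (c (-i)) _ ih) (K_smul (c i ^ n) _ (K_gen (n * i)))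
      convert this using 1
      have e : ((n + 1 : ℕ) : ZMod p) * i = n * i + i := by push_cast; ring
      rw [e]
      ext x
      simp only [Pi.add_apply, Pi.sub_apply, Pi.smul_apply, smul_eq_mul]
      ring
  -- After p steps the walk returns to 0. By Fermat the coefficient there is c(-i)^p - c(i)^p =
  -- c(-i) - c(i), nonzero by non-symmetry and scaled to 1.
  obtain ⟨h, hh⟩ := K_smul (c (-i) - c i)⁻¹ _ (K_pow p)
  have hne : c (-i) - c i ≠ 0 := sub_ne_zero.2 (Ne.symm hi)
  have h1 := D.eq_one 0 h fun x hx => by rw [hh]; simp [hx]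
  rw [hh, CharP.cast_eq_zero, zero_mul, ZMod.pow_card, ZMod.pow_card] at h1
  rw [← commutatorElement_eq_one_iff_commute, ← hY, ← h1]
  simp only [Pi.smul_apply, Pi.sub_apply, Pi.single_eq_same, smul_eq_mul, mul_one]
  rw [inv_mul_cancel₀ hne, pow_val_one]

/-- In characteristic other than `3` a nonsymmetric vector has two independent columns. -/
theorem exists_det_ne_zero (hp : 3 < p) {c : ZMod p → ZMod p}
    (hz : ∀ i, c i = 0 ↔ c (-i) = 0) {i : ZMod p} (hi : c i ≠ c (-i)) :
    ∃ i k l : ZMod p, i ≠ 0 ∧ c (-i) ≠ 0 ∧ k ≠ 0 ∧ k ≠ i ∧ l ≠ 0 ∧ l ≠ i ∧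
      c (i - k) * c (-l) - c (i - l) * c (-k) ≠ 0 := by
  by_contra! hdep
  have hi0 : i ≠ 0 := by rintro rfl; simp at hi
  have hci : c i ≠ 0 := fun h => hi (by rw [h, (hz i).1 h])
  have hci' : c (-i) ≠ 0 := fun h => hci ((hz i).2 h)
  have hnat : ∀ n : ℕ, 0 < n → n < p → (n : ZMod p) ≠ 0 := fun n h0 hn h => by
    rw [ZMod.natCast_eq_zero_iff] at h
    exact absurd (Nat.le_of_dvd h0 h) (by omega)
  have h2 : (2 : ZMod p) ≠ 0 := by exact_mod_cast hnat 2 (by omega) (by omega)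
  have h3 : (3 : ZMod p) ≠ 0 := by exact_mod_cast hnat 3 (by omega) (by omega)
  have dep : ∀ j, j ≠ 0 → c j ≠ 0 → ∀ k l, k ≠ 0 → k ≠ -j → l ≠ 0 → l ≠ -j →
      c (k + j) * c l = c (l + j) * c k := by
    intro j hj hcj k l hk hkj hl hlj
    have h := hdep j (-k) (-l) hj (fun h => hcj ((hz j).2 h)) (neg_ne_zero.2 hk)
      (fun h => hkj (by rw [← h, neg_neg])) (neg_ne_zero.2 hl) (fun h => hlj (by rw [← h, neg_neg]))
    rw [sub_neg_eq_add, sub_neg_eq_add, neg_neg, neg_neg, sub_eq_zero, add_comm j k,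
      add_comm j l] at h
    exact h
  have hne : ∀ a b : ZMod p, a - b ≠ 0 → a ≠ b := fun a b h => sub_ne_zero.1 h
  have m2 : (2 : ZMod p) * i ≠ 0 := mul_ne_zero h2 hi0
  have m3 : (3 : ZMod p) * i ≠ 0 := mul_ne_zero h3 hi0
  have hii : i ≠ -i := hne _ _ (by convert m2 using 1; ring)
  set r := c (i + i) / c i with hr
  have step : ∀ l, l ≠ 0 → l ≠ -i → c (l + i) = r * c l := by
    intro l hl hli
    have h := dep i hi0 hci i l hi0 hii hl hli
    rw [hr, div_mul_eq_mul_div, eq_div_iff hci, h]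
  have hr0 : r ≠ 0 := by
    intro h
    have := step (-(2 * i)) (neg_ne_zero.2 m2) (hne _ _ (by
      rw [show -(2 * i) - -i = -i by ring]; exact neg_ne_zero.2 hi0))
    rw [h, zero_mul, show -(2 * i) + i = -i by ring] at this
    exact hci' this
  have geom : ∀ n : ℕ, n + 1 < p → c (((n + 1 : ℕ) : ZMod p) * i) = r ^ n * c i := by
    intro n hn
    induction n with
    | zero => simp
    | succ n ih =>
      have e : ((n + 1 + 1 : ℕ) : ZMod p) * i = ((n + 1 : ℕ) : ZMod p) * i + i := by
        push_cast; ring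
      rw [e, step, ih (by omega), pow_succ]
      · ring
      · exact mul_ne_zero (hnat _ (by omega) (by omega)) hi0
      · refine hne _ _ ?_
        rw [sub_neg_eq_add, ← e]
        exact mul_ne_zero (hnat _ (by omega) (by omega)) hi0
  have g2 : c (2 * i) = r * c i := by simpa using geom 1 (by omega)
  have g3 : c (3 * i) = r ^ 2 * c i := by simpa using geom 2 (by omega)
  have glast : c (-i) = r ^ (p - 2) * c i := by
    have := geom (p - 2) (by omega)
    rw [show p - 2 + 1 = p - 1 by omega, Nat.cast_sub (by omega)] at this
    simpa using this
  -- Shifting by 2i compares c(3i) c(-i) with c(i)², which forces r^p = 1, so r = 1 by Fermat and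
  -- c(-i) = c(i).
  have hd := dep (2 * i) m2 (by rw [g2]; exact mul_ne_zero hr0 hci) i (-i) hi0
    (hne _ _ (by convert m3 using 1; ring)) (neg_ne_zero.2 hi0)
    (hne _ _ (by convert hi0 using 1; ring))
  rw [show i + 2 * i = 3 * i by ring, show -i + 2 * i = i by ring, g3, glast] at hd
  have hrp : r ^ p = 1 := by
    have : r ^ p = r ^ 2 * r ^ (p - 2) := by rw [← pow_add]; congr 1; omega
    rw [this]
    have h4 : c i * c i ≠ 0 := mul_ne_zero hci hci
    apply mul_right_cancel₀ h4
    linear_combination hd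
  rw [ZMod.pow_card] at hrp
  exact hi (by rw [glast, hrp]; simp)

/-- For `p = 3` the commutator `⁅B, A ^ c (-i)⁆` commutes with `A` even if `c (-i) = -c i`. -/
theorem commute_commutator_of_three (D : IsDirectedSystem q β A B c) (hp : p = 3) {i : ZMod p}
    (hi : i ≠ 0) (hci : c i ≠ 0) (h : c (-i) = -c i) :
    Commute ⁅B, A ^ (c (-i)).val⁆ A := by
  have h3 : (3 : ZMod p) = 0 := by
    simpa [hp] using CharP.cast_eq_zero (ZMod p) p
  have key : ∀ j : ZMod p, j ≠ 0 → c (-j) = -c j →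
      Commute ⁅B, A ^ (c (-j)).val⁆ (A ^ (c j).val * B) := by
    intro j hj hcj
    have e : j - -j = -j := by linear_combination j * h3
    have hjj : j ≠ -j := fun h => hj (by linear_combination j * h3 - h)
    -- In characteristic 3, j - (-j) = -j, so the image of β(-j) β(0) at j is A^(c(-j)) A^(c j) = 1.
    have h1 := D.commute_commutator hj (β (-j) * β 0) (by
      rw [map_mul, D.map_other _ _ hjj, D.map_other _ _ hj, sub_zero, e, hcj,
        pow_val_neg D.pow_left, inv_mul_cancel])
    rwa [map_mul, D.map_self, D.map_other _ _ (neg_ne_zero.2 hj).symm, zero_sub, neg_neg] at h1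
  have k1 := key i hi h
  have k2 := key (-i) (neg_ne_zero.2 hi) (by rw [neg_neg, h, neg_neg])
  rw [neg_neg] at k2
  have hE : A ^ (c i).val = (A ^ (c (-i)).val)⁻¹ := by rw [h, pow_val_neg D.pow_left, inv_inv]
  have hE3 : (A ^ (c (-i)).val) ^ 3 = 1 := by
    rw [← pow_mul, mul_comm, pow_mul, ← hp, D.pow_left, one_pow]
  have hcn : c (-i) ≠ 0 := by rw [h]; exact neg_ne_zero.2 hci
  rw [hE] at k1 k2
  suffices hs : Commute ⁅B, A ^ (c (-i)).val⁆ (A ^ (c (-i)).val) from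
    D.commute_of_commute_pow hcn hs
  generalize A ^ (c (-i)).val = E at *
  have e1 : ⁅B, E⁻¹⁆ = E⁻¹ * ⁅B, E⁆⁻¹ * E := by simp only [commutatorElement_def]; group
  rw [e1] at k2
  -- Conjugating `k2` by E and using E² = E⁻¹ shows that ⁅B, E⁆ commutes with E⁻¹BE⁻¹. By `k1` it
  -- commutes with E⁻¹B, hence with the quotient E.
  have k3 : Commute ⁅B, E⁆ (E⁻¹ * B * E⁻¹) := by
    have := (Commute.conj_iff E).2 k2
    rw [show E * (E⁻¹ * ⁅B, E⁆⁻¹ * E) * E⁻¹ = ⁅B, E⁆⁻¹ by group, Commute.inv_left_iff] at this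
    convert this using 1
    have : E⁻¹ = E ^ 2 := by rw [inv_eq_iff_mul_eq_one, ← pow_succ', hE3]
    rw [← mul_assoc, ← pow_two, ← this]
  have := k3.inv_right.mul_right k1
  simpa [mul_assoc] using this

/-- If `c` is not symmetric then the images `A` and `B` commute. -/
theorem commute (D : IsDirectedSystem q β A B c) (hp : 3 ≤ p) {i : ZMod p} (hi : c i ≠ c (-i)) :
    Commute B A := by
  by_cases hz : ∃ j, c j = 0 ∧ c (-j) ≠ 0
  · obtain ⟨j, h0, h1⟩ := hz
    exact D.commute_of_eq_zero h0 h1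
  push Not at hz
  have hz' : ∀ j, c j = 0 ↔ c (-j) = 0 :=
    fun j => ⟨hz j, fun h => by simpa using hz (-j) h⟩
  rcases hp.eq_or_lt with hp | hp
  · subst hp
    have hi0 : i ≠ 0 := by rintro rfl; simp at hi
    have hci : c i ≠ 0 := fun h => hi (by rw [h, hz i h])
    have hci' : c (-i) ≠ 0 := fun h => hci ((hz' i).2 h)
    have h : c (-i) = -c i := by
      exact eq_neg_of_ne_zmod_three _ _ hi hci hci'
    exact D.commute_of_commute_commutator hci' (D.commute_commutator_of_three rfl hi0 hci h) hi
  · obtain ⟨j, k, l, hj, hcj, hk0, hkj, hl0, hlj, hdet⟩ := exists_det_ne_zero hp hz' hi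
    exact D.commute_of_commute_commutator hcj
      (D.commute_commutator_of_det_ne_zero hj hk0 hkj hl0 hlj hdet) hi

end IsDirectedSystem

/-! ### Sections -/

namespace TreeAut

variable {X : Type*}

theorem sect_nil (g : TreeAut X) : g.sect [] = g := by
  ext w; rfl

theorem sect_append (g : TreeAut X) (u v : List X) : g.sect (u ++ v) = (g.sect u).sect v := by
  apply RelIso.ext
  intro w
  have h1 := g.append_sect (u ++ v) w
  rw [List.append_assoc, g.append_sect u, g.append_sect u v, (g.sect u).append_sect,
    List.append_assoc, List.append_cancel_left_eq, List.append_cancel_left_eq] at h1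
  exact h1.symm

theorem sect_cons (g : TreeAut X) (x : X) (v : List X) :
    g.sect (x :: v) = (g.sect [x]).sect v := g.sect_append [x] v

theorem sect_mul (g h : TreeAut X) (u : List X) :
    (g * h).sect u = g.sect (h u) * h.sect u := by
  apply RelIso.ext
  intro w
  have h1 := (g * h).append_sect u w
  rw [RelIso.mul_apply, RelIso.mul_apply, h.append_sect, g.append_sect,
    List.append_cancel_left_eq] at h1
  exact h1.symm

theorem one_sect (u : List X) : (1 : TreeAut X).sect u = 1 := by
  apply RelIso.ext
  intro w
  have h1 := (1 : TreeAut X).append_sect u w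
  rw [RelIso.one_apply, RelIso.one_apply, List.append_cancel_left_eq] at h1
  exact h1.symm

theorem ext_of_sect {g h : TreeAut X} (h1 : ∀ x, g [x] = h [x])
    (h2 : ∀ x, g.sect [x] = h.sect [x]) : g = h := by
  apply RelIso.ext
  intro w
  cases w with
  | nil => rw [g.map_nil, h.map_nil]
  | cons x w =>
    have e : x :: w = [x] ++ w := rfl
    rw [e, g.append_sect, h.append_sect, h1, h2]

end TreeAut

/-! ### The generators -/

section Generators

variable {p : ℕ}

theorem rootedAut_cons (x : ZMod p) (w : List (ZMod p)) :
    rootedAut p (x :: w) = (x + 1) :: w := rfl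

theorem rootedAut_pow_cons (n : ℕ) (x : ZMod p) (w : List (ZMod p)) :
    (rootedAut p ^ n) (x :: w) = (x + n) :: w := by
  induction n with
  | zero => simp
  | succ n ih =>
    rw [pow_succ', RelIso.mul_apply, ih]
    simp [rootedAut_cons, add_assoc]

theorem rootedAut_pow_sect (n : ℕ) (x : ZMod p) : (rootedAut p ^ n).sect [x] = 1 := by
  apply RelIso.ext
  intro w
  have h := (rootedAut p ^ n).append_sect [x] w
  rw [List.singleton_append, rootedAut_pow_cons, rootedAut_pow_cons] at h
  simpa using h.symm

theorem rootedAut_pow_self : rootedAut p ^ p = 1 := by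
  apply TreeAut.ext_of_sect <;> intro x
  · rw [rootedAut_pow_cons]; simp
  · rw [rootedAut_pow_sect, TreeAut.one_sect]

variable [NeZero p] (e : Fin (p - 1) → ZMod p)

theorem zeroCons_zero : zeroCons e 0 = 0 := by simp [zeroCons]

theorem directedAut_cons (x : ZMod p) (w : List (ZMod p)) : directedAut e (x :: w) =
    x :: if x = 0 then directedAut e w else (rootedAut p ^ (zeroCons e x).val) w := rfl

theorem directedAut_singleton (x : ZMod p) : directedAut e [x] = [x] := by
  rw [directedAut_cons, TreeAut.map_nil, TreeAut.map_nil, ite_self]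

theorem directedAut_sect_zero : (directedAut e).sect [0] = directedAut e := by
  apply RelIso.ext
  intro w
  have h := (directedAut e).append_sect [0] w
  rw [directedAut_singleton, List.singleton_append, directedAut_cons, if_pos rfl] at h
  simpa using h.symm

theorem directedAut_sect {x : ZMod p} (hx : x ≠ 0) :
    (directedAut e).sect [x] = rootedAut p ^ (zeroCons e x).val := by
  apply RelIso.ext
  intro w
  have h := (directedAut e).append_sect [x] w
  rw [directedAut_singleton, List.singleton_append, directedAut_cons, if_neg hx] at h
  simpa using h.symm

theorem directedAut_pow_cons (n : ℕ) (x : ZMod p) (w : List (ZMod p)) :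
    (directedAut e ^ n) (x :: w) = x :: if x = 0 then (directedAut e ^ n) w else
      ((rootedAut p ^ (zeroCons e x).val) ^ n) w := by
  induction n with
  | zero => simp
  | succ n ih =>
    rw [pow_succ', RelIso.mul_apply, ih, directedAut_cons]
    split_ifs with h
    · rfl
    · rw [pow_succ' _ n, RelIso.mul_apply]

theorem directedAut_pow_self : directedAut e ^ p = 1 := by
  apply RelIso.ext
  intro w
  induction w with
  | nil => rw [TreeAut.map_nil, TreeAut.map_nil]
  | cons x w ih =>
    rw [directedAut_pow_cons, ih, ← pow_mul, mul_comm, pow_mul, rootedAut_pow_self, one_pow]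
    simp

theorem exists_zeroCons_ne_of_not_isSymmetric {e : Fin (p - 1) → ZMod p} (he : ¬ IsSymmetric e) :
    ∃ i, zeroCons e i ≠ zeroCons e (-i) := by
  by_contra! h
  refine he fun i => ?_
  have hp : 0 < p := NeZero.pos p
  have hi := i.isLt
  have hv : ((i.val + 1 : ℕ) : ZMod p).val = i.val + 1 := ZMod.val_natCast_of_lt (by omega)
  have h0 : ((i.val + 1 : ℕ) : ZMod p) ≠ 0 := fun h0 => by
    rw [h0, ZMod.val_zero] at hv; omega
  have hn : (-((i.val + 1 : ℕ) : ZMod p)).val = p - (i.val + 1) := by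
    have : NeZero ((i.val + 1 : ℕ) : ZMod p) := ⟨h0⟩
    rw [ZMod.val_neg_of_ne_zero, hv]
  have := h ((i.val + 1 : ℕ) : ZMod p)
  rw [zeroCons, zeroCons, dif_neg h0, dif_neg (neg_ne_zero.2 h0)] at this
  convert this using 2
  · ext; simp only [hv]; omega
  · ext; simp only [hn, Fin.val_rev]; omega

end Generators

/-! ### Exponents of the elements of a GGS-group -/

section Exponents

variable {p : ℕ}

/-- The image of the letter `0`; for elements of a GGS-group this is the exponent of the rotation
of the first level. -/
def rot (g : TreeAut (ZMod p)) : ZMod p := g.rootPerm 0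

theorem apply_zero (g : TreeAut (ZMod p)) : g [0] = [rot g] := (g.map_singleton 0).symm

theorem rot_eq_of_apply {g : TreeAut (ZMod p)} {k : ZMod p} (h : g [0] = [k]) : rot g = k := by
  rw [apply_zero] at h
  exact List.singleton_injective h

theorem rot_one : rot (1 : TreeAut (ZMod p)) = 0 := rot_eq_of_apply rfl

theorem rot_pow_mul (n : ℕ) (g : TreeAut (ZMod p)) : rot (rootedAut p ^ n * g) = rot g + n :=
  rot_eq_of_apply (by rw [RelIso.mul_apply, apply_zero, rootedAut_pow_cons])

theorem rot_rootedAut_mul (g : TreeAut (ZMod p)) : rot (rootedAut p * g) = rot g + 1 := by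
  simpa using rot_pow_mul 1 g

theorem rootedAut_pow_mul_sect (n : ℕ) (g : TreeAut (ZMod p)) (x : ZMod p) :
    (rootedAut p ^ n * g).sect [x] = g.sect [x] := by
  rw [TreeAut.sect_mul, ← g.map_singleton, rootedAut_pow_sect, one_mul]

theorem rootedAut_mul_sect (g : TreeAut (ZMod p)) (x : ZMod p) :
    (rootedAut p * g).sect [x] = g.sect [x] := by
  simpa using rootedAut_pow_mul_sect 1 g x

variable [NeZero p]

theorem rootedAut_mem (e : Fin (p - 1) → ZMod p) : rootedAut p ∈ ggsGroup e :=
  Subgroup.subset_closure (by simp)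

theorem directedAut_mem (e : Fin (p - 1) → ZMod p) : directedAut e ∈ ggsGroup e :=
  Subgroup.subset_closure (by simp)

/-- Both generators have order dividing p, so their inverses are positive powers and need no
separate cases. -/
theorem ggsGroup_induction {e : Fin (p - 1) → ZMod p} {P : TreeAut (ZMod p) → Prop}
    (one : P 1) (rooted : ∀ g ∈ ggsGroup e, P g → P (rootedAut p * g))
    (directed : ∀ g ∈ ggsGroup e, P g → P (directedAut e * g)) :
    ∀ g ∈ ggsGroup e, P g := by
  have key : ∀ x ∈ ggsGroup e, (∀ g ∈ ggsGroup e, P g → P (x * g)) → ∀ n : ℕ,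
      ∀ g ∈ ggsGroup e, P g → P (x ^ n * g) := by
    intro x hx h n
    induction n with
    | zero => intro g _ hg; simpa using hg
    | succ n ih =>
      intro g hg hP
      rw [pow_succ', mul_assoc]
      exact h _ (mul_mem (pow_mem hx n) hg) (ih g hg hP)
  have inv : ∀ x : TreeAut (ZMod p), x ^ p = 1 → x⁻¹ = x ^ (p - 1) := by
    intro x hx
    rw [inv_eq_iff_mul_eq_one, ← pow_succ', Nat.sub_add_cancel (NeZero.pos p), hx]
  intro g hg
  suffices P g ∧ g ∈ ggsGroup e from this.1
  refine Subgroup.closure_induction_left (p := fun g _ => P g ∧ g ∈ ggsGroup e)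
    ⟨one, one_mem _⟩ ?_ ?_ hg
  · rintro x hx y - ⟨h1, h2⟩
    refine ⟨?_, mul_mem (Subgroup.subset_closure hx) h2⟩
    rcases hx with rfl | rfl
    · exact rooted y h2 h1
    · exact directed y h2 h1
  · rintro x hx y - ⟨h1, h2⟩
    refine ⟨?_, mul_mem (inv_mem (Subgroup.subset_closure hx)) h2⟩
    rcases hx with rfl | rfl
    · rw [inv _ rootedAut_pow_self]
      exact key _ (rootedAut_mem e) rooted _ y h2 h1
    · rw [inv _ (directedAut_pow_self e)]
      exact key _ (directedAut_mem e) directed _ y h2 h1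

variable {e : Fin (p - 1) → ZMod p}

theorem rot_directedAut_mul (g : TreeAut (ZMod p)) : rot (directedAut e * g) = rot g :=
  rot_eq_of_apply (by rw [RelIso.mul_apply, apply_zero, directedAut_singleton])

theorem apply_singleton {g : TreeAut (ZMod p)} (hg : g ∈ ggsGroup e) (x : ZMod p) :
    g [x] = [x + rot g] := by
  refine ggsGroup_induction (P := fun g => g [x] = [x + rot g]) ?_ ?_ ?_ g hg
  · rw [rot_one, add_zero, RelIso.one_apply]
  · intro g _ h
    rw [rot_rootedAut_mul, RelIso.mul_apply, h, ← pow_one (rootedAut p), rootedAut_pow_cons]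
    simp [add_assoc]
  · intro g _ h
    rw [rot_directedAut_mul, RelIso.mul_apply, h, directedAut_singleton]

theorem directedAut_mul_sect {g : TreeAut (ZMod p)} (hg : g ∈ ggsGroup e) (x : ZMod p) :
    (directedAut e * g).sect [x] = (if x + rot g = 0 then directedAut e else
      rootedAut p ^ (zeroCons e (x + rot g)).val) * g.sect [x] := by
  rw [TreeAut.sect_mul, apply_singleton hg]
  split_ifs with h
  · rw [h, directedAut_sect_zero]
  · rw [directedAut_sect e h]

theorem sect_singleton_mem {g : TreeAut (ZMod p)} (hg : g ∈ ggsGroup e) (x : ZMod p) :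
    g.sect [x] ∈ ggsGroup e := by
  refine ggsGroup_induction (P := fun g => g.sect [x] ∈ ggsGroup e) ?_ ?_ ?_ g hg
  · rw [TreeAut.one_sect]; exact one_mem _
  · intro g _ h
    rwa [rootedAut_mul_sect]
  · intro g hg h
    rw [directedAut_mul_sect hg]
    refine mul_mem ?_ h
    split_ifs
    · exact directedAut_mem e
    · exact pow_mem (rootedAut_mem e) _

theorem isSelfSimilar_ggsGroup (e : Fin (p - 1) → ZMod p) : IsSelfSimilar (ggsGroup e) := by
  intro g hg u
  induction u generalizing g with
  | nil => rwa [TreeAut.sect_nil]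
  | cons x u ih => rw [TreeAut.sect_cons]; exact ih _ (sect_singleton_mem hg x)

theorem rot_sect_directedAut_mul {g : TreeAut (ZMod p)} (hg : g ∈ ggsGroup e) (x : ZMod p) :
    rot ((directedAut e * g).sect [x]) = rot (g.sect [x]) + zeroCons e (x + rot g) := by
  rw [directedAut_mul_sect hg]
  split_ifs with h
  · rw [rot_directedAut_mul, h, zeroCons_zero, add_zero]
  · rw [rot_pow_mul, ZMod.natCast_zmod_val]

theorem rot_mul {g h : TreeAut (ZMod p)} (hg : g ∈ ggsGroup e) :
    rot (g * h) = rot g + rot h :=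
  rot_eq_of_apply (by rw [RelIso.mul_apply, apply_zero, apply_singleton hg, add_comm])

/-- `β` is the exponent of `b` in the abelianization of the GGS-group `⟨a, b⟩`. -/
structure IsDirectedExponent (e : Fin (p - 1) → ZMod p) (β : TreeAut (ZMod p) → ZMod p) :
    Prop where
  map_one : β 1 = 0
  map_rootedAut_mul : ∀ g ∈ ggsGroup e, β (rootedAut p * g) = β g
  map_directedAut_mul : ∀ g ∈ ggsGroup e, β (directedAut e * g) = β g + 1

namespace IsDirectedExponent

variable {β : TreeAut (ZMod p) → ZMod p}

theorem map_rootedAut_pow_mul (hβ : IsDirectedExponent e β) (n : ℕ) {g : TreeAut (ZMod p)}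
    (hg : g ∈ ggsGroup e) : β (rootedAut p ^ n * g) = β g := by
  induction n with
  | zero => simp
  | succ n ih =>
    rw [pow_succ', mul_assoc, hβ.map_rootedAut_mul _ (mul_mem (pow_mem (rootedAut_mem e) n) hg),
      ih]

theorem map_directedAut_pow (hβ : IsDirectedExponent e β) (n : ℕ) :
    β (directedAut e ^ n) = n := by
  induction n with
  | zero => simpa using hβ.map_one
  | succ n ih =>
    rw [pow_succ', hβ.map_directedAut_mul _ (pow_mem (directedAut_mem e) n), ih, Nat.cast_succ]

/-- Both sides change by c(x + rot g) under left multiplication by b: the new factor puts b at the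
letter j = -rot g and a^(c(x - j)) at each other letter x. -/
theorem rot_sect (hβ : IsDirectedExponent e β) {g : TreeAut (ZMod p)} (hg : g ∈ ggsGroup e)
    (x : ZMod p) : rot (g.sect [x]) = ∑ j, β (g.sect [j]) * zeroCons e (x - j) := by
  refine ggsGroup_induction (P := fun g => rot (g.sect [x]) =
    ∑ j, β (g.sect [j]) * zeroCons e (x - j)) ?_ ?_ ?_ g hg
  · simp [TreeAut.one_sect, rot_one, hβ.map_one]
  · intro g _ h
    simpa only [rootedAut_mul_sect] using h
  · intro g hg h
    have h1 : ∀ j, β ((directedAut e * g).sect [j]) =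
        β (g.sect [j]) + if j = -rot g then 1 else 0 := by
      intro j
      rw [directedAut_mul_sect hg]
      simp only [← add_eq_zero_iff_eq_neg]
      split_ifs with hj
      · exact hβ.map_directedAut_mul _ (sect_singleton_mem hg j)
      · rw [add_zero, hβ.map_rootedAut_pow_mul _ (sect_singleton_mem hg j)]
    rw [rot_sect_directedAut_mul hg, h]
    simp [h1, add_mul, Finset.sum_add_distrib]

end IsDirectedExponent

end Exponents

/-! ### Construction of the exponent of b from moments of c -/

section Moments

variable {p : ℕ} [Fact p.Prime]

theorem exists_moment_ne_zero {f : ZMod p → ZMod p} (hf : f ≠ 0) :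
    ∃ m : ℕ, ∑ x, x ^ m * f x ≠ 0 := by
  by_contra! h
  apply hf
  funext k
  have hpoly : ∀ P : Polynomial (ZMod p), ∑ x, P.eval x * f x = 0 := by
    intro P
    induction P using Polynomial.induction_on' with
    | add P Q hP hQ => simp [add_mul, Finset.sum_add_distrib, hP, hQ]
    | monomial n a =>
      simp only [Polynomial.eval_monomial, mul_assoc, ← Finset.mul_sum, h n, mul_zero]
  -- By Fermat this polynomial is the indicator function of k.
  have h1 := hpoly (1 - (Polynomial.X - Polynomial.C k) ^ (p - 1))
  rw [Finset.sum_eq_single k] at h1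
  · have : p - 1 ≠ 0 := by have := (Fact.out : p.Prime).two_le; omega
    simpa [this] using h1
  · intro x _ hx
    simp [ZMod.pow_card_sub_one_eq_one (sub_ne_zero.2 hx)]
  · simp

/-- Expanding (x - k)^m binomially, all terms but the leading one are multiples of lower moments. -/
theorem moment_shift {f : ZMod p → ZMod p} {m : ℕ} (hm : ∀ l < m, ∑ x, x ^ l * f x = 0)
    (k : ZMod p) : ∑ x, x ^ m * f (x + k) = ∑ x, x ^ m * f x := by
  rw [← Equiv.sum_comp (Equiv.subRight k)]
  simp only [Equiv.subRight_apply, sub_add_cancel]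
  simp only [sub_eq_add_neg, add_pow, Finset.sum_mul]
  rw [Finset.sum_comm, Finset.sum_range_succ]
  rw [Finset.sum_eq_zero, zero_add]
  · simp
  · intro l hl
    rw [← mul_zero ((-k) ^ (m - l) * (m.choose l : ZMod p)), ← hm l (Finset.mem_range.1 hl),
      Finset.mul_sum]
    exact Finset.sum_congr rfl fun x _ => by ring

/-- Left multiplication by b adds a translate of c to the vector of rotations of the sections, and
left multiplication by a leaves that vector unchanged. The first nonvanishing moment of c ignores
translation, so the same moment of this vector, normalized, counts the factors b. It depends on the
automorphism only, not on a word for it. -/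
theorem exists_isDirectedExponent {e : Fin (p - 1) → ZMod p} (he : zeroCons e ≠ 0) :
    ∃ β, IsDirectedExponent e β := by
  classical
  have hex := exists_moment_ne_zero he
  set m := Nat.find hex
  set μ := ∑ x, x ^ m * zeroCons e x
  have hμ : μ ≠ 0 := Nat.find_spec hex
  have hlow : ∀ l < m, ∑ x, x ^ l * zeroCons e x = 0 := fun l hl => by
    simpa using Nat.find_min hex hl
  refine ⟨fun g => μ⁻¹ * ∑ x, x ^ m * rot (g.sect [x]), ?_, ?_, ?_⟩
  · simp [TreeAut.one_sect, rot_one]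
  · intro g _
    simp only [rootedAut_mul_sect]
  · intro g hg
    simp only [rot_sect_directedAut_mul hg, mul_add, Finset.sum_add_distrib]
    rw [moment_shift hlow, inv_mul_cancel₀ hμ]

end Moments

/-! ### The stabilizer of the first level and branching -/

section Stabilizer

variable {p : ℕ} [NeZero p]

theorem rot_inv {e : Fin (p - 1) → ZMod p} {g : TreeAut (ZMod p)} (hg : g ∈ ggsGroup e) :
    rot g⁻¹ = -rot g := by
  rw [eq_neg_iff_add_eq_zero, add_comm, ← rot_mul hg, mul_inv_cancel, rot_one]

/-- The stabilizer of the first level in a GGS-group. -/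
def levelStab (e : Fin (p - 1) → ZMod p) : Subgroup (TreeAut (ZMod p)) where
  carrier := {g | g ∈ ggsGroup e ∧ rot g = 0}
  mul_mem' := fun ⟨h1, h2⟩ ⟨h3, h4⟩ => ⟨mul_mem h1 h3, by rw [rot_mul h1, h2, h4, add_zero]⟩
  one_mem' := ⟨one_mem _, rot_one⟩
  inv_mem' := fun ⟨h1, h2⟩ => ⟨inv_mem h1, by rw [rot_inv h1, h2, neg_zero]⟩

theorem apply_singleton_of_mem_levelStab {e : Fin (p - 1) → ZMod p} {g : TreeAut (ZMod p)}
    (hg : g ∈ levelStab e) (x : ZMod p) : g [x] = [x] := by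
  rw [apply_singleton hg.1, hg.2, add_zero]

/-- The section at a vertex of the first level, as a homomorphism. -/
def levelSect (e : Fin (p - 1) → ZMod p) (x : ZMod p) : levelStab e →* ggsGroup e where
  toFun h := ⟨h.1.sect [x], sect_singleton_mem h.2.1 x⟩
  map_one' := Subtype.ext (TreeAut.one_sect _)
  map_mul' g h := Subtype.ext (by
    change (g.1 * h.1).sect [x] = g.1.sect [x] * h.1.sect [x]
    rw [TreeAut.sect_mul, apply_singleton_of_mem_levelStab h.2])

theorem coe_levelSect {e : Fin (p - 1) → ZMod p} (x : ZMod p) (h : levelStab e) :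
    (levelSect e x h : TreeAut (ZMod p)) = h.1.sect [x] := rfl

variable {e : Fin (p - 1) → ZMod p}

/-- Conjugation by a power of a permutes the first level sections cyclically. -/
theorem exists_conj (k : ZMod p) {h : TreeAut (ZMod p)} (hh : h ∈ levelStab e) :
    ∃ h' : levelStab e, ∀ x, (levelSect e x h' : TreeAut (ZMod p)) = h.sect [x - k] := by
  have hm : h * rootedAut p ^ (-k).val ∈ ggsGroup e :=
    mul_mem hh.1 (pow_mem (rootedAut_mem e) _)
  refine ⟨⟨rootedAut p ^ k.val * (h * rootedAut p ^ (-k).val),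
    mul_mem (pow_mem (rootedAut_mem e) _) hm, ?_⟩, fun x => ?_⟩
  · rw [rot_pow_mul, rot_mul hh.1, hh.2]
    have := rot_pow_mul (-k).val (1 : TreeAut (ZMod p))
    rw [mul_one, rot_one] at this
    rw [this]
    simp
  · rw [coe_levelSect, rootedAut_pow_mul_sect, TreeAut.sect_mul, rootedAut_pow_cons,
      rootedAut_pow_sect, mul_one, ZMod.natCast_zmod_val, sub_eq_add_neg]

theorem directedAut_mem_levelStab (e : Fin (p - 1) → ZMod p) : directedAut e ∈ levelStab e :=
  ⟨directedAut_mem e, rot_eq_of_apply (directedAut_singleton e 0)⟩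

variable (e) in
/-- The conjugate of `b` by the `j`-th power of `a`. -/
noncomputable def directedConj (j : ZMod p) : levelStab e :=
  (exists_conj j (directedAut_mem_levelStab e)).choose

theorem levelSect_directedConj (x j : ZMod p) :
    (levelSect e x (directedConj e j) : TreeAut (ZMod p)) = (directedAut e).sect [x - j] :=
  (exists_conj j (directedAut_mem_levelStab e)).choose_spec x

variable (e) in
/-- The generator `a` as an element of the GGS-group. -/
def rootedGen : ggsGroup e := ⟨rootedAut p, rootedAut_mem e⟩

variable (e) in
/-- The generator `b` as an element of the GGS-group. -/
def directedGen : ggsGroup e := ⟨directedAut e, directedAut_mem e⟩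

theorem rootedGen_pow : rootedGen e ^ p = 1 := Subtype.ext rootedAut_pow_self

theorem directedGen_pow : directedGen e ^ p = 1 := Subtype.ext (directedAut_pow_self e)

theorem levelSect_directedConj_self (j : ZMod p) :
    levelSect e j (directedConj e j) = directedGen e :=
  Subtype.ext (by rw [levelSect_directedConj, sub_self, directedAut_sect_zero]; rfl)

theorem levelSect_directedConj_of_ne {x j : ZMod p} (h : x ≠ j) :
    levelSect e x (directedConj e j) = rootedGen e ^ (zeroCons e (x - j)).val :=
  Subtype.ext (by rw [levelSect_directedConj, directedAut_sect e (sub_ne_zero.2 h)]; rfl)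

variable (e) in
/-- The elements `g` of the GGS-group for which `(g, 1, …, 1)` belongs to the GGS-group. -/
def rigid : Subgroup (ggsGroup e) :=
  (⨅ (x : ZMod p) (_ : x ≠ 0), (levelSect e x).ker).map (levelSect e 0)

theorem mem_rigid {g : ggsGroup e} :
    g ∈ rigid e ↔ ∃ h, (∀ x, x ≠ 0 → levelSect e x h = 1) ∧ levelSect e 0 h = g := by
  simp [rigid, Subgroup.mem_map, Subgroup.mem_iInf, MonoidHom.mem_ker]

theorem exists_levelSect_eq_single {g : ggsGroup e} (hg : g ∈ rigid e) (y : ZMod p) :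
    ∃ h, levelSect e y h = g ∧ ∀ x, x ≠ y → levelSect e x h = 1 := by
  obtain ⟨h, h1, rfl⟩ := mem_rigid.1 hg
  obtain ⟨h', hh'⟩ := exists_conj y h.2
  refine ⟨h', Subtype.ext ?_, fun x hx => ?_⟩
  · rw [hh', sub_self]; rfl
  · rw [← h1 (x - y) (sub_ne_zero.2 hx)]
    exact Subtype.ext (hh' x)

theorem exists_levelSect_eq_of_mem_rigid {m : ZMod p → ggsGroup e} (hm : ∀ x, m x ∈ rigid e) :
    ∃ h, ∀ x, levelSect e x h = m x := by
  classical
  suffices ∀ s : Finset (ZMod p), ∃ h, ∀ x, levelSect e x h = if x ∈ s then m x else 1 by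
    simpa using this Finset.univ
  intro s
  induction s using Finset.induction_on with
  | empty => exact ⟨1, by simp⟩
  | insert y s hy ih =>
    obtain ⟨h, hh⟩ := ih
    obtain ⟨k, hk1, hk2⟩ := exists_levelSect_eq_single (hm y) y
    refine ⟨h * k, fun x => ?_⟩
    by_cases hx : x = y
    · subst hx; simp [hh, hk1, hy]
    · simp [hh, hk2 x hx, hx]

theorem closure_gens : Subgroup.closure {rootedGen e, directedGen e} = ⊤ := by
  rw [Subgroup.eq_top_iff']
  rintro ⟨g, hg⟩
  have : ∀ g ∈ ggsGroup e, ∃ g' ∈ Subgroup.closure {rootedGen e, directedGen e},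
      (g' : TreeAut (ZMod p)) = g := by
    refine ggsGroup_induction ⟨1, one_mem _, rfl⟩ ?_ ?_
    · rintro g hg ⟨g', h1, rfl⟩
      exact ⟨rootedGen e * g', mul_mem (Subgroup.subset_closure (by simp)) h1, rfl⟩
    · rintro g hg ⟨g', h1, rfl⟩
      exact ⟨directedGen e * g', mul_mem (Subgroup.subset_closure (by simp)) h1, rfl⟩
  obtain ⟨g', h1, h2⟩ := this g hg
  rwa [← show g' = ⟨g, hg⟩ from Subtype.ext h2]

end Stabilizer

/-! ### Commutativity modulo the rigid subgroup -/

section Branching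

variable {p : ℕ} [Fact p.Prime] {e : Fin (p - 1) → ZMod p}

theorem levelSect_surjective {i : ZMod p} (hi : zeroCons e i ≠ 0) :
    Function.Surjective (levelSect e 0) := by
  have hi0 : i ≠ 0 := by rintro rfl; exact hi (zeroCons_zero e)
  rw [← MonoidHom.range_eq_top, ← top_le_iff, ← closure_gens, Subgroup.closure_le]
  rintro _ (rfl | rfl)
  · refine ⟨directedConj e (-i) ^ ((zeroCons e i)⁻¹).val, ?_⟩
    rw [map_pow, levelSect_directedConj_of_ne (neg_ne_zero.2 hi0).symm, zero_sub, neg_neg,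
      ← eq_pow_val_inv rootedGen_pow hi]
  · exact ⟨directedConj e 0, levelSect_directedConj_self 0⟩

/-- `rigid e` is the image of a normal subgroup of the level stabilizer under a surjection. -/
theorem rigid_normal {i : ZMod p} (hi : zeroCons e i ≠ 0) : (rigid e).Normal := by
  refine Subgroup.Normal.map ?_ _ (levelSect_surjective hi)
  exact Subgroup.normal_iInf_normal fun x => Subgroup.normal_iInf_normal fun _ => inferInstance

/-- Being a tuple of sections depends only on the classes modulo `rigid e`, since arbitrary tuples
of rigid elements are realized. -/
theorem exists_levelSect_eq [(rigid e).Normal] {t : levelStab e} {g : ZMod p → ggsGroup e}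
    (h : ∀ x, (levelSect e x t : ggsGroup e ⧸ rigid e) = g x) :
    ∃ k, ∀ x, levelSect e x k = g x := by
  obtain ⟨k, hk⟩ := exists_levelSect_eq_of_mem_rigid (m := fun x => (levelSect e x t)⁻¹ * g x)
    fun x => QuotientGroup.eq.1 (h x)
  exact ⟨t * k, fun x => by rw [map_mul, hk, mul_inv_cancel_left]⟩

theorem isDirectedSystem_quotient [(rigid e).Normal] :
    IsDirectedSystem (fun x => (QuotientGroup.mk' (rigid e)).comp (levelSect e x))
      (directedConj e) (rootedGen e : ggsGroup e ⧸ rigid e) (directedGen e) (zeroCons e) where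
  zero := zeroCons_zero e
  pow_left := by rw [← QuotientGroup.mk_pow, rootedGen_pow, QuotientGroup.mk_one]
  pow_right := by rw [← QuotientGroup.mk_pow, directedGen_pow, QuotientGroup.mk_one]
  map_self j := by
    rw [MonoidHom.comp_apply, levelSect_directedConj_self]; rfl
  map_other x j h := by
    rw [MonoidHom.comp_apply, levelSect_directedConj_of_ne h]; rfl
  eq_one y h hx := by
    classical
    obtain ⟨k, hk⟩ := exists_levelSect_eq (t := h)
      (g := fun x => if x = y then levelSect e y h else 1) (fun x => by
        by_cases hxy : x = y
        · simp [hxy]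
        · simpa [hxy] using hx x hxy)
    -- Conjugation moves the only surviving section from y to 0, where `rigid` is defined.
    obtain ⟨k', hk'⟩ := exists_conj (-y) k.2
    refine (QuotientGroup.eq_one_iff _).2 (mem_rigid.2 ⟨k', fun x hx => ?_, ?_⟩)
    · have h1 : levelSect e x k' = levelSect e (x - -y) k := Subtype.ext (hk' x)
      rw [h1, hk, if_neg (by simpa using hx)]
    · have h1 : levelSect e 0 k' = levelSect e (0 - -y) k := Subtype.ext (hk' 0)
      rw [h1, hk, if_pos (by simp)]

theorem mk_eq [(rigid e).Normal]
    (hcomm : Commute (directedGen e : ggsGroup e ⧸ rigid e) (rootedGen e))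
    {β : TreeAut (ZMod p) → ZMod p} (hβ : IsDirectedExponent e β) (g : ggsGroup e) :
    (g : ggsGroup e ⧸ rigid e) =
      (rootedGen e : ggsGroup e ⧸ rigid e) ^ (rot g.1).val *
        (directedGen e : ggsGroup e ⧸ rigid e) ^ (β g.1).val := by
  have hA : (rootedGen e : ggsGroup e ⧸ rigid e) ^ p = 1 := isDirectedSystem_quotient.pow_left
  have hB : (directedGen e : ggsGroup e ⧸ rigid e) ^ p = 1 := isDirectedSystem_quotient.pow_right
  suffices ∀ g ∈ ggsGroup e, ∀ hg : g ∈ ggsGroup e,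
      ((⟨g, hg⟩ : ggsGroup e) : ggsGroup e ⧸ rigid e) =
      (rootedGen e : ggsGroup e ⧸ rigid e) ^ (rot g).val *
        (directedGen e : ggsGroup e ⧸ rigid e) ^ (β g).val from this g.1 g.2 g.2
  refine ggsGroup_induction ?_ ?_ ?_
  · intro hg
    rw [rot_one, hβ.map_one, pow_val_zero, pow_val_zero, mul_one]
    rfl
  · intro g hg h _
    rw [rot_rootedAut_mul, hβ.map_rootedAut_mul g hg, add_comm, pow_val_add hA, pow_val_one,
      mul_assoc, ← h hg]
    rfl
  · intro g hg h _
    rw [rot_directedAut_mul, hβ.map_directedAut_mul g hg, add_comm (β g), pow_val_add hB,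
      pow_val_one, ← mul_assoc, ← (hcomm.pow_right _).eq, mul_assoc, ← h hg]
    rfl

/-- The tuples of sections of elements of the first level stabilizer are characterized by the
exponents of their entries. -/
theorem exists_sect_eq (hp : 3 ≤ p) (he : ¬ IsSymmetric e) {β : TreeAut (ZMod p) → ZMod p}
    (hβ : IsDirectedExponent e β) {g : ZMod p → TreeAut (ZMod p)} (hg : ∀ x, g x ∈ ggsGroup e)
    (h : ∀ x, rot (g x) = ∑ j, β (g j) * zeroCons e (x - j)) :
    ∃ k ∈ levelStab e, ∀ x, k.sect [x] = g x := by
  obtain ⟨i, hi⟩ := exists_zeroCons_ne_of_not_isSymmetric he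
  have : (rigid e).Normal := by
    by_cases h0 : zeroCons e i = 0
    · exact rigid_normal (i := -i) (fun h1 => hi (by rw [h0, h1]))
    · exact rigid_normal h0
  have hcomm := (isDirectedSystem_quotient (e := e)).commute hp hi
  have hA : (rootedGen e : ggsGroup e ⧸ rigid e) ^ p = 1 := isDirectedSystem_quotient.pow_left
  -- The witness is a product of the conjugates of b at j, raised to β(g j), over j in s. For the
  -- full set the exponents of A are the prescribed rotations.
  have key : ∀ s : Finset (ZMod p), ∃ t : levelStab e, ∀ x,
      (levelSect e x t : ggsGroup e ⧸ rigid e) =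
        (rootedGen e : ggsGroup e ⧸ rigid e) ^ (∑ j ∈ s, β (g j) * zeroCons e (x - j)).val *
        (directedGen e : ggsGroup e ⧸ rigid e) ^ (if x ∈ s then β (g x) else 0).val := by
    intro s
    induction s using Finset.induction_on with
    | empty => exact ⟨1, by simp⟩
    | insert j s hj ih =>
      obtain ⟨t, ht⟩ := ih
      refine ⟨directedConj e j ^ (β (g j)).val * t, fun x => ?_⟩
      rw [map_mul, map_pow, QuotientGroup.mk_mul, QuotientGroup.mk_pow, ht,
        Finset.sum_insert hj, pow_val_add hA]
      by_cases hx : x = j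
      · subst hx
        rw [levelSect_directedConj_self, if_neg hj, if_pos (Finset.mem_insert_self _ _),
          sub_self, zeroCons_zero, mul_zero, pow_val_zero, pow_val_zero, one_mul, mul_one,
          (hcomm.pow_pow _ _).eq]
      · rw [levelSect_directedConj_of_ne hx, QuotientGroup.mk_pow, mul_comm (β (g j)),
          pow_val_mul hA, mul_assoc]
        simp [hx]
  obtain ⟨t, ht⟩ := key Finset.univ
  obtain ⟨k, hk⟩ := exists_levelSect_eq (t := t) (g := fun x => ⟨g x, hg x⟩) fun x => by
    rw [ht, mk_eq hcomm hβ ⟨g x, hg x⟩]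
    simp [h x]
  exact ⟨k.1, k.2, fun x => congrArg Subtype.val (hk x)⟩

end Branching

/-! ### Contraction and the nucleus -/

section Contraction

open scoped Pointwise

theorem sect_mem_pow {X : Type*} {S T : Set (TreeAut X)}
    (h : ∀ g ∈ S, ∀ x, g.sect [x] ∈ T) (n : ℕ) : ∀ g ∈ S ^ n, ∀ x, g.sect [x] ∈ T ^ n := by
  induction n with
  | zero =>
    rintro _ rfl x
    rw [TreeAut.one_sect]
    rfl
  | succ n ih =>
    intro g hg x
    rw [pow_succ] at hg ⊢
    obtain ⟨g, hg, k, hk, rfl⟩ := hg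
    change (g * k).sect [x] ∈ _
    rw [TreeAut.sect_mul, ← k.map_singleton]
    exact Set.mul_mem_mul (ih g hg _) (h k hk x)

variable {p : ℕ} [Fact p.Prime] (e : Fin (p - 1) → ZMod p)

theorem directedAut_pow_singleton (n : ℕ) (x : ZMod p) : (directedAut e ^ n) [x] = [x] := by
  rw [directedAut_pow_cons, TreeAut.map_nil, TreeAut.map_nil, ite_self]

theorem directedAut_pow_sect_zero (n : ℕ) : (directedAut e ^ n).sect [0] = directedAut e ^ n := by
  induction n with
  | zero => rw [pow_zero, TreeAut.one_sect]
  | succ n ih => rw [pow_succ, TreeAut.sect_mul, directedAut_singleton, ih, directedAut_sect_zero]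

theorem directedAut_pow_sect (n : ℕ) {x : ZMod p} (hx : x ≠ 0) :
    (directedAut e ^ n).sect [x] = rootedAut p ^ ((zeroCons e x).val * n) := by
  induction n with
  | zero => rw [pow_zero, TreeAut.one_sect, mul_zero, pow_zero]
  | succ n ih =>
    rw [pow_succ, TreeAut.sect_mul, directedAut_singleton, ih, directedAut_sect e hx, ← pow_add,
      mul_add_one]

/-- The powers of the two generators. -/
def core : Set (TreeAut (ZMod p)) :=
  {g | ∃ k l : ZMod p, k * l = 0 ∧ g = rootedAut p ^ k.val * directedAut e ^ l.val}

theorem rootedAut_pow_mem_core (n : ℕ) : rootedAut p ^ n ∈ core e :=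
  ⟨n, 0, mul_zero _, by
    rw [pow_val_zero, mul_one, ZMod.val_natCast, ← pow_eq_pow_mod _ rootedAut_pow_self]⟩

theorem directedAut_pow_mem_core (n : ℕ) : directedAut e ^ n ∈ core e :=
  ⟨0, n, zero_mul _, by
    rw [pow_val_zero, one_mul, ZMod.val_natCast, ← pow_eq_pow_mod _ (directedAut_pow_self e)]⟩

theorem core_subset : core e ⊆ ggsGroup e := by
  rintro _ ⟨k, l, -, rfl⟩
  exact mul_mem (pow_mem (rootedAut_mem e) _) (pow_mem (directedAut_mem e) _)

theorem core_finite : (core e).Finite :=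
  (Set.finite_range fun x : ZMod p × ZMod p =>
    rootedAut p ^ x.1.val * directedAut e ^ x.2.val).subset (by
      rintro _ ⟨k, l, -, rfl⟩
      exact ⟨(k, l), rfl⟩)

theorem directedAut_pow_sect_mem_core (n : ℕ) (x : ZMod p) :
    (directedAut e ^ n).sect [x] ∈ core e := by
  by_cases hx : x = 0
  · rw [hx, directedAut_pow_sect_zero]
    exact directedAut_pow_mem_core e n
  · rw [directedAut_pow_sect e n hx]
    exact rootedAut_pow_mem_core e _

variable {e}

theorem sect_singleton_mem_core {g : TreeAut (ZMod p)} (hg : g ∈ core e) (x : ZMod p) :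
    g.sect [x] ∈ core e := by
  obtain ⟨k, l, -, rfl⟩ := hg
  rw [rootedAut_pow_mul_sect]
  exact directedAut_pow_sect_mem_core e _ x

theorem sect_mem_core {g : TreeAut (ZMod p)} (hg : g ∈ core e) (u : List (ZMod p)) :
    g.sect u ∈ core e := by
  induction u generalizing g with
  | nil => rwa [TreeAut.sect_nil]
  | cons x u ih => rw [TreeAut.sect_cons]; exact ih (sect_singleton_mem_core hg x)

variable (e) in
/-- The elements `a ^ i * b ^ j * a ^ k`. -/
def syllables : Set (TreeAut (ZMod p)) :=
  {g | ∃ i j k : ℕ, g = rootedAut p ^ i * directedAut e ^ j * rootedAut p ^ k}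

theorem sect_mem_core_of_mem_syllables {g : TreeAut (ZMod p)} (hg : g ∈ syllables e)
    (x : ZMod p) : g.sect [x] ∈ core e := by
  obtain ⟨i, j, k, rfl⟩ := hg
  rw [mul_assoc, rootedAut_pow_mul_sect, TreeAut.sect_mul, rootedAut_pow_cons,
    rootedAut_pow_sect, mul_one]
  exact directedAut_pow_sect_mem_core e _ _

theorem core_eq_or {g : TreeAut (ZMod p)} (hg : g ∈ core e) :
    ∃ n : ℕ, g = rootedAut p ^ n ∨ g = directedAut e ^ n := by
  obtain ⟨k, l, h, rfl⟩ := hg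
  rcases mul_eq_zero.1 h with rfl | rfl
  · exact ⟨l.val, Or.inr (by simp)⟩
  · exact ⟨k.val, Or.inl (by simp)⟩

theorem core_mul_core_subset : core e * core e ⊆ syllables e := by
  rintro _ ⟨g, hg, h, hh, rfl⟩
  obtain ⟨m, rfl | rfl⟩ := core_eq_or hg <;> obtain ⟨n, rfl | rfl⟩ := core_eq_or hh
  · exact ⟨m, 0, n, by simp⟩
  · exact ⟨m, n, 0, by simp⟩
  · exact ⟨0, m, n, by simp⟩
  · exact ⟨0, m + n, 0, by simp [pow_add]⟩

/-- Each syllable has sections that are powers of one generator, and two such powers form a single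
syllable. Thus syllable length halves at each level, which drives the contraction. -/
theorem sect_mem_syllables {g : TreeAut (ZMod p)}
    (hg : g ∈ syllables e * syllables e) (x : ZMod p) : g.sect [x] ∈ syllables e := by
  rw [← pow_two] at hg
  apply core_mul_core_subset
  rw [← pow_two]
  exact sect_mem_pow (fun g hg x => sect_mem_core_of_mem_syllables hg x) 2 g hg x

theorem sect_mem_core_of_mem_pow (m : ℕ) :
    ∀ g ∈ syllables e ^ 2 ^ m, ∀ u : List (ZMod p), m + 1 ≤ u.length → g.sect u ∈ core e := by
  induction m with
  | zero =>
    intro g hg u hu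
    rw [pow_zero, pow_one] at hg
    cases u with
    | nil => simp at hu
    | cons x u =>
      rw [TreeAut.sect_cons]
      exact sect_mem_core (sect_mem_core_of_mem_syllables hg x) u
  | succ m ih =>
    intro g hg u hu
    rw [pow_succ' 2, pow_mul, pow_two] at hg
    cases u with
    | nil => simp at hu
    | cons x u =>
      rw [TreeAut.sect_cons]
      exact ih _ (sect_mem_pow (fun g hg x => sect_mem_syllables hg x) _ g hg x) u
        (by simpa using hu)

theorem isAbsorbing_core : IsAbsorbing (ggsGroup e) (core e) := by
  refine ⟨core_finite e, core_subset e, fun g hg => ?_⟩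
  have h : ∀ g ∈ ggsGroup e, ∃ m : ℕ, g ∈ syllables e ^ m := by
    refine ggsGroup_induction ⟨0, rfl⟩ ?_ ?_
    · rintro g _ ⟨m, hm⟩
      exact ⟨m + 1, pow_succ' (syllables e) m ▸ Set.mul_mem_mul ⟨1, 0, 0, by simp⟩ hm⟩
    · rintro g _ ⟨m, hm⟩
      exact ⟨m + 1, pow_succ' (syllables e) m ▸ Set.mul_mem_mul ⟨0, 1, 0, by simp⟩ hm⟩
  obtain ⟨m, hm⟩ := h g hg
  have h1 : (1 : TreeAut (ZMod p)) ∈ syllables e := ⟨0, 0, 0, by simp⟩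
  exact ⟨m + 1, sect_mem_core_of_mem_pow m g
    (Set.pow_subset_pow_right h1 Nat.lt_two_pow_self.le hm)⟩

theorem isContracting_ggsGroup (e : Fin (p - 1) → ZMod p) :
    IsContracting (ggsGroup e) :=
  ⟨isSelfSimilar_ggsGroup e, core e, isAbsorbing_core⟩

end Contraction

section Nucleus

variable {p : ℕ} [Fact p.Prime] {e : Fin (p - 1) → ZMod p}

theorem directedAut_pow_sect_replicate (n m : ℕ) :
    (directedAut e ^ n).sect (List.replicate m 0) = directedAut e ^ n := by
  induction m with
  | zero => exact TreeAut.sect_nil _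
  | succ m ih => rw [List.replicate_succ, TreeAut.sect_cons, directedAut_pow_sect_zero, ih]

/-- Powers of b recur as their own sections along 0, 0, …, and each power of a is a section of a
power of b just off this ray. Both therefore occur at arbitrarily deep levels and lie in every
absorbing set. -/
theorem nucleus_ggsGroup (he : zeroCons e ≠ 0) : nucleus (ggsGroup e) = core e := by
  refine Set.Subset.antisymm (Set.sInter_subset_of_mem isAbsorbing_core)
    (Set.subset_sInter ?_)
  rintro M ⟨-, -, hM⟩ g hg
  obtain ⟨k, l, h, rfl⟩ := hg
  rcases mul_eq_zero.1 h with rfl | rfl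
  · obtain ⟨n, hn⟩ := hM _ (pow_mem (directedAut_mem e) l.val)
    have := hn (List.replicate n 0) (by simp)
    rw [directedAut_pow_sect_replicate] at this
    rwa [pow_val_zero, one_mul]
  · obtain ⟨i, hi⟩ := Function.ne_iff.1 he
    have hi0 : i ≠ 0 := by rintro rfl; exact hi (zeroCons_zero e)
    -- The exponent is chosen so that the section at the letter i is a^k.
    obtain ⟨n, hn⟩ := hM _ (pow_mem (directedAut_mem e) ((zeroCons e i)⁻¹ * k).val)
    have := hn (List.replicate n 0 ++ [i]) (by simp)
    rw [TreeAut.sect_append, directedAut_pow_sect_replicate, directedAut_pow_sect e _ hi0,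
      pow_mul, ← pow_val_mul rootedAut_pow_self, mul_inv_cancel_left₀ hi] at this
    rwa [pow_val_zero, mul_one]

end Nucleus

/-! ### Portraits -/

section Portraits

variable {X : Type} [Fintype X] {N : Set (TreeAut X)}

theorem exists_portrait_zero {g : TreeAut X} :
    (∃ P, IsPortrait N g P ∧ P.depth ≤ 0) ↔ g ∈ N := by
  constructor
  · rintro ⟨P, hP, h⟩
    cases hP with
    | leaf _ hg => exact hg
    | node _ hg c hc => simp [Portrait.depth] at h
  · exact fun hg => ⟨_, .leaf g hg, le_rfl⟩

/-- Closure of N under sections makes the recursion uniform: it also covers elements of N, whose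
portraits stop at once. -/
theorem exists_portrait_succ (hN : ∀ g ∈ N, ∀ x, g.sect [x] ∈ N) {g : TreeAut X} {n : ℕ} :
    (∃ P, IsPortrait N g P ∧ P.depth ≤ n + 1) ↔
      ∀ x, ∃ P, IsPortrait N (g.sect [x]) P ∧ P.depth ≤ n := by
  constructor
  · rintro ⟨P, hP, h⟩ x
    cases hP with
    | leaf _ hg => exact ⟨_, .leaf _ (hN g hg x), Nat.zero_le _⟩
    | node _ hg c hc =>
      refine ⟨c x, hc x, ?_⟩
      simp only [Portrait.depth, add_le_add_iff_right, Finset.sup_le_iff] at h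
      exact h x (Finset.mem_univ x)
  · intro h
    by_cases hg : g ∈ N
    · exact ⟨_, .leaf g hg, Nat.zero_le _⟩
    · choose c hc hd using h
      refine ⟨_, .node g hg c hc, ?_⟩
      simp only [Portrait.depth, add_le_add_iff_right, Finset.sup_le_iff]
      exact fun x _ => hd x

end Portraits

/-! ### Counting -/

section Counting

variable {p : ℕ} [Fact p.Prime] {e : Fin (p - 1) → ZMod p}

variable (e) in
/-- The elements with portrait of depth at most `n`, relative to the powers of the generators. -/
def ball (n : ℕ) : Set (TreeAut (ZMod p)) :=
  {g | g ∈ ggsGroup e ∧ ∃ P, IsPortrait (core e) g P ∧ P.depth ≤ n}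

theorem portraitGrowth_ggsGroup (he : zeroCons e ≠ 0) (n : ℕ) :
    portraitGrowth (ggsGroup e) n = Nat.card (ball e n) := by
  rw [portraitGrowth, nucleus_ggsGroup he]
  rfl

theorem ball_zero : ball e 0 = core e := by
  ext g
  simp only [ball, exists_portrait_zero, Set.mem_ofPred_eq, and_iff_right_iff_imp]
  exact fun h => core_subset e h

theorem mem_ball_succ {g : TreeAut (ZMod p)} {n : ℕ} :
    g ∈ ball e (n + 1) ↔ g ∈ ggsGroup e ∧ ∀ x, g.sect [x] ∈ ball e n := by
  simp only [ball, Set.mem_ofPred_eq,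
    exists_portrait_succ (fun g hg x => sect_singleton_mem_core (e := e) hg x)]
  exact ⟨fun h => ⟨h.1, fun x => ⟨sect_singleton_mem h.1 x, h.2 x⟩⟩,
    fun h => ⟨h.1, fun x => (h.2 x).2⟩⟩

/-- Left multiplication by a does not change the first level sections. The index must be positive:
in general the core is not invariant, as ab shows. -/
theorem rootedAut_pow_mul_mem_ball (k : ℕ) {g : TreeAut (ZMod p)} {n : ℕ}
    (hg : g ∈ ball e (n + 1)) : rootedAut p ^ k * g ∈ ball e (n + 1) := by
  rw [mem_ball_succ] at hg ⊢
  refine ⟨mul_mem (pow_mem (rootedAut_mem e) k) hg.1, fun x => ?_⟩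
  rw [rootedAut_pow_mul_sect]
  exact hg.2 x

variable (e) in
/-- The elements of a ball that fix the first level. -/
def stabBall (n : ℕ) : Set (TreeAut (ZMod p)) := {g | g ∈ ball e n ∧ rot g = 0}

theorem derotate_mem_stabBall {g : TreeAut (ZMod p)} {n : ℕ} (hg : g ∈ ball e (n + 1)) :
    rootedAut p ^ (-rot g).val * g ∈ stabBall e (n + 1) :=
  ⟨rootedAut_pow_mul_mem_ball _ hg, by rw [rot_pow_mul, ZMod.natCast_zmod_val, add_neg_cancel]⟩

theorem rotate_derotate (k : ZMod p) (g : TreeAut (ZMod p)) :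
    rootedAut p ^ k.val * (rootedAut p ^ (-k).val * g) = g := by
  rw [pow_val_neg rootedAut_pow_self, mul_inv_cancel_left]

theorem derotate_rotate (k : ZMod p) (g : TreeAut (ZMod p)) :
    rootedAut p ^ (-k).val * (rootedAut p ^ k.val * g) = g := by
  rw [pow_val_neg rootedAut_pow_self, inv_mul_cancel_left]

theorem rot_rotate (k : ZMod p) {g : TreeAut (ZMod p)} (hg : rot g = 0) :
    rot (rootedAut p ^ k.val * g) = k := by
  rw [rot_pow_mul, hg, zero_add, ZMod.natCast_zmod_val]

theorem card_ball_succ (n : ℕ) :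
    Nat.card (ball e (n + 1)) = p * Nat.card (stabBall e (n + 1)) := by
  let φ : ball e (n + 1) ≃ ZMod p × stabBall e (n + 1) :=
    { toFun := fun g => (rot g.1, ⟨_, derotate_mem_stabBall g.2⟩)
      invFun := fun x => ⟨rootedAut p ^ x.1.val * x.2.1, rootedAut_pow_mul_mem_ball _ x.2.2.1⟩
      left_inv := fun g => Subtype.ext (rotate_derotate _ _)
      right_inv := fun x => by
        have h := rot_rotate x.1 x.2.2.2
        refine Prod.ext h (Subtype.ext ?_)
        simp only [h, derotate_rotate] }
  rw [Nat.card_congr φ, Nat.card_prod, Nat.card_zmod]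

theorem eq_of_sect_eq {g h : TreeAut (ZMod p)} (hg : g ∈ levelStab e) (hh : h ∈ levelStab e)
    (H : ∀ x, g.sect [x] = h.sect [x]) : g = h :=
  TreeAut.ext_of_sect (fun x => by
    rw [apply_singleton_of_mem_levelStab hg, apply_singleton_of_mem_levelStab hh]) H

theorem card_stabBall_succ_succ (hp : 3 ≤ p) (he : ¬ IsSymmetric e)
    {β : TreeAut (ZMod p) → ZMod p} (hβ : IsDirectedExponent e β) (n : ℕ) :
    Nat.card (stabBall e (n + 2)) = Nat.card (stabBall e (n + 1)) ^ p := by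
  have hmem : ∀ (g : stabBall e (n + 2)) (x : ZMod p), g.1.sect [x] ∈ ball e (n + 1) :=
    fun g x => (mem_ball_succ.1 g.2.1).2 x
  have hstab : ∀ g : stabBall e (n + 2), g.1 ∈ levelStab e := fun g => ⟨g.2.1.1, g.2.2⟩
  let φ : stabBall e (n + 2) → ZMod p → stabBall e (n + 1) :=
    -- Each section is stripped of its rotation. The b-exponents survive and determine the lost
    -- rotations through `rot_sect`.
    fun g x => ⟨_, derotate_mem_stabBall (hmem g x)⟩
  have hφ : Function.Bijective φ := by
    constructor
    · intro g h hgh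
      have h1 : ∀ x, rootedAut p ^ (-rot (g.1.sect [x])).val * g.1.sect [x] =
          rootedAut p ^ (-rot (h.1.sect [x])).val * h.1.sect [x] :=
        fun x => congrArg Subtype.val (congrFun hgh x)
      have h2 : ∀ x, β (g.1.sect [x]) = β (h.1.sect [x]) := by
        intro x
        rw [← hβ.map_rootedAut_pow_mul _ (hmem g x).1, h1, hβ.map_rootedAut_pow_mul _ (hmem h x).1]
      have h3 : ∀ x, rot (g.1.sect [x]) = rot (h.1.sect [x]) := by
        intro x
        rw [hβ.rot_sect g.2.1.1, hβ.rot_sect h.2.1.1]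
        simp only [h2]
      exact Subtype.ext (eq_of_sect_eq (hstab g) (hstab h) fun x =>
        mul_left_cancel (by simpa only [h3] using h1 x))
    · intro s
      -- These are the rotations that the linear relation forces on a tuple with the given
      -- b-exponents.
      let k : ZMod p → ZMod p := fun x => ∑ j, β (s j).1 * zeroCons e (x - j)
      have hrot : ∀ x, rot (rootedAut p ^ (k x).val * (s x).1) = k x :=
        fun x => rot_rotate _ (s x).2.2
      obtain ⟨g, hg, hs⟩ := exists_sect_eq hp he hβ
        (g := fun x => rootedAut p ^ (k x).val * (s x).1)
        (fun x => mul_mem (pow_mem (rootedAut_mem e) _) (s x).2.1.1) fun x => by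
          rw [hrot]
          exact Finset.sum_congr rfl fun j _ => by rw [hβ.map_rootedAut_pow_mul _ (s j).2.1.1]
      refine ⟨⟨g, mem_ball_succ.2 ⟨hg.1, fun x => ?_⟩, hg.2⟩, ?_⟩
      · rw [hs]
        exact rootedAut_pow_mul_mem_ball _ (s x).2.1
      · funext x
        refine Subtype.ext ?_
        simp only [φ, hs, hrot, derotate_rotate]
  rw [Nat.card_congr (Equiv.ofBijective φ hφ), Nat.card_fun, Nat.card_zmod]

theorem vecMul_circulantMatrix (n : ZMod p → ZMod p) (x : ZMod p) :
    Matrix.vecMul n (circulantMatrix e) x = ∑ j, n j * zeroCons e (x - j) := rfl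

theorem rot_core {k l : ZMod p} :
    rot (rootedAut p ^ k.val * directedAut e ^ l.val) = k :=
  rot_rotate k (rot_eq_of_apply (directedAut_pow_singleton e _ 0))

theorem IsDirectedExponent.map_core {β : TreeAut (ZMod p) → ZMod p}
    (hβ : IsDirectedExponent e β) (k l : ZMod p) :
    β (rootedAut p ^ k.val * directedAut e ^ l.val) = l := by
  rw [hβ.map_rootedAut_pow_mul _ (pow_mem (directedAut_mem e) _), hβ.map_directedAut_pow,
    ZMod.natCast_zmod_val]

theorem IsDirectedExponent.mem_core_iff {β : TreeAut (ZMod p) → ZMod p}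
    (hβ : IsDirectedExponent e β) {g : TreeAut (ZMod p)} : g ∈ core e ↔
      rot g * β g = 0 ∧ g = rootedAut p ^ (rot g).val * directedAut e ^ (β g).val := by
  constructor
  · rintro ⟨k, l, h, rfl⟩
    rw [rot_core, hβ.map_core]
    exact ⟨h, rfl⟩
  · exact fun h => ⟨_, _, h.1, h.2⟩

theorem card_stabBall_one (hp : 3 ≤ p) (he : ¬ IsSymmetric e)
    {β : TreeAut (ZMod p) → ZMod p} (hβ : IsDirectedExponent e β) :
    Nat.card (stabBall e 1) =
      Nat.card {n : ZMod p → ZMod p // Matrix.vecMul n (circulantMatrix e) * n = 0} := by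
  have hmem : ∀ (g : stabBall e 1) (x : ZMod p), g.1.sect [x] ∈ core e := fun g x => by
    rw [← ball_zero]; exact (mem_ball_succ.1 g.2.1).2 x
  have hstab : ∀ g : stabBall e 1, g.1 ∈ levelStab e := fun g => ⟨g.2.1.1, g.2.2⟩
  let φ : stabBall e 1 → {n : ZMod p → ZMod p // Matrix.vecMul n (circulantMatrix e) * n = 0} :=
    fun g => ⟨fun x => β (g.1.sect [x]), by
      funext x
      rw [Pi.mul_apply, vecMul_circulantMatrix, ← hβ.rot_sect g.2.1.1]
      exact (hβ.mem_core_iff.1 (hmem g x)).1⟩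
  have hφ : Function.Bijective φ := by
    constructor
    · intro g h hgh
      have h2 : ∀ x, β (g.1.sect [x]) = β (h.1.sect [x]) :=
        fun x => congrFun (congrArg Subtype.val hgh) x
      refine Subtype.ext (eq_of_sect_eq (hstab g) (hstab h) fun x => ?_)
      rw [(hβ.mem_core_iff.1 (hmem g x)).2, (hβ.mem_core_iff.1 (hmem h x)).2,
        hβ.rot_sect g.2.1.1, hβ.rot_sect h.2.1.1]
      simp only [h2]
    · rintro ⟨n, hn⟩
      let k : ZMod p → ZMod p := fun x => ∑ j, n j * zeroCons e (x - j)
      let s : ZMod p → TreeAut (ZMod p) :=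
        fun x => rootedAut p ^ (k x).val * directedAut e ^ (n x).val
      -- The equation for n says exactly that the two exponents of each entry have product zero.
      have hcore : ∀ x, s x ∈ core e := fun x => ⟨k x, n x, congrFun hn x, rfl⟩
      obtain ⟨g, hg, hs⟩ := exists_sect_eq hp he hβ (g := s) (fun x => core_subset e (hcore x))
        fun x => by simp only [s, rot_core, hβ.map_core, k]
      refine ⟨⟨g, mem_ball_succ.2 ⟨hg.1, fun x => ?_⟩, hg.2⟩, Subtype.ext (funext fun x => ?_)⟩
      · rw [hs, ball_zero]
        exact hcore x
      · simp only [φ, hs, s, hβ.map_core]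
  exact Nat.card_congr (Equiv.ofBijective φ hφ)

theorem card_core {β : TreeAut (ZMod p) → ZMod p} (hβ : IsDirectedExponent e β) :
    Nat.card (core e) = 1 + 2 * (p - 1) := by
  have hp := (Fact.out : p.Prime).pos
  -- The second piece omits 0 so that the identity is counted once.
  let S : Set (ZMod p × ZMod p) := (fun k => (k, 0)) '' Set.univ ∪ (fun l => (0, l)) '' {0}ᶜ
  have hinj : Set.InjOn (fun x : ZMod p × ZMod p =>
      rootedAut p ^ x.1.val * directedAut e ^ x.2.val) S := by
    rintro ⟨k, l⟩ _ ⟨k', l'⟩ _ h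
    have h1 := congrArg rot h
    have h2 := congrArg β h
    simp only [rot_core, hβ.map_core] at h1 h2
    rw [h1, h2]
  have himg : core e = (fun x : ZMod p × ZMod p =>
      rootedAut p ^ x.1.val * directedAut e ^ x.2.val) '' S := by
    ext g
    constructor
    · rintro ⟨k, l, h, rfl⟩
      refine ⟨(k, l), ?_, rfl⟩
      by_cases hl : l = 0
      · exact Or.inl ⟨k, trivial, by rw [hl]⟩
      · exact Or.inr ⟨l, hl, by rw [(mul_eq_zero.1 h).resolve_right hl]⟩
    · rintro ⟨_, ⟨k, -, rfl⟩ | ⟨l, -, rfl⟩, rfl⟩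
      · exact ⟨k, 0, mul_zero k, rfl⟩
      · exact ⟨0, l, zero_mul l, rfl⟩
  have hdisj : Disjoint ((fun k : ZMod p => (k, (0 : ZMod p))) '' Set.univ)
      ((fun l : ZMod p => ((0 : ZMod p), l)) '' {0}ᶜ) := by
    rw [Set.disjoint_left]
    rintro _ ⟨k, -, rfl⟩ ⟨l, hl, h⟩
    exact hl (Prod.ext_iff.1 h).2
  rw [Nat.card_coe_set_eq, himg, hinj.ncard_image, Set.ncard_union_eq hdisj,
    Set.ncard_image_of_injective _ (fun a b h => (Prod.ext_iff.1 h).1),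
    Set.ncard_image_of_injective _ (fun a b h => (Prod.ext_iff.1 h).2), Set.ncard_univ,
    Set.ncard_compl, Set.ncard_singleton, Nat.card_zmod]
  omega

/-- The equation is homogeneous of degree 2, so rescaling by s identifies the two solution sets. -/
theorem solutionCount_eq {s : ZMod p} (hs : s ≠ 0) : solutionCount e s = solutionCount e 1 := by
  have key : ∀ {t r : ZMod p} (n : ZMod p → ZMod p),
      Matrix.vecMul n (circulantMatrix e) * n = 0 ∧ ∑ i, n i = t →
      Matrix.vecMul (r • n) (circulantMatrix e) * (r • n) = 0 ∧ ∑ i, (r • n) i = r * t := by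
    rintro t r n ⟨h1, rfl⟩
    rw [Matrix.smul_vecMul, smul_mul_smul_comm, h1, smul_zero]
    exact ⟨rfl, by simp [Finset.mul_sum]⟩
  refine Nat.card_congr
    { toFun := fun n => ⟨s⁻¹ • n.1, by simpa [hs] using key (r := s⁻¹) n.1 n.2⟩
      invFun := fun n => ⟨s • n.1, by simpa using key (r := s) n.1 n.2⟩
      left_inv := fun n => Subtype.ext (smul_inv_smul₀ hs _)
      right_inv := fun n => Subtype.ext (inv_smul_smul₀ hs _) }

theorem card_solutions :
    Nat.card {n : ZMod p → ZMod p // Matrix.vecMul n (circulantMatrix e) * n = 0} =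
      solutionCount e 0 + (p - 1) * solutionCount e 1 := by
  have h : ∀ s : ZMod p, Nat.card {n : {n : ZMod p → ZMod p //
      Matrix.vecMul n (circulantMatrix e) * n = 0} // ∑ i, n.1 i = s} = solutionCount e s :=
    fun s => Nat.card_congr (Equiv.subtypeSubtypeEquivSubtypeInter
      (fun n : ZMod p → ZMod p => Matrix.vecMul n (circulantMatrix e) * n = 0)
      (fun n => ∑ i, n i = s))
  rw [← Nat.card_congr (Equiv.sigmaFiberEquiv fun n : {n : ZMod p → ZMod p //
      Matrix.vecMul n (circulantMatrix e) * n = 0} => ∑ i, n.1 i), Nat.card_sigma]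
  simp only [h]
  rw [← Finset.add_sum_erase _ _ (Finset.mem_univ (0 : ZMod p)),
    Finset.sum_congr rfl fun s hs => solutionCount_eq (Finset.ne_of_mem_erase hs)]
  simp [ZMod.card]

theorem card_stabBall_succ (hp : 3 ≤ p) (he : ¬ IsSymmetric e)
    {β : TreeAut (ZMod p) → ZMod p} (hβ : IsDirectedExponent e β) (n : ℕ) :
    Nat.card (stabBall e (n + 1)) =
      (solutionCount e 0 + (p - 1) * solutionCount e 1) ^ p ^ n := by
  induction n with
  | zero => rw [card_stabBall_one hp he hβ, card_solutions, pow_zero, pow_one]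
  | succ n ih => rw [card_stabBall_succ_succ hp he hβ, ih, ← pow_mul, ← pow_succ]

end Counting

end GGS

theorem mainTheorem3 (p : ℕ) [Fact p.Prime] (hp : 3 ≤ p) (e : Fin (p - 1) → ZMod p)
    (he : ¬ GGS.IsSymmetric e) :
    GGS.IsContracting (GGS.ggsGroup e) ∧
    GGS.portraitGrowth (GGS.ggsGroup e) 0 = 1 + 2 * (p - 1) ∧
    ∀ n : ℕ, 1 ≤ n →
      GGS.portraitGrowth (GGS.ggsGroup e) n =
        p * (GGS.solutionCount e 0 + (p - 1) * GGS.solutionCount e 1) ^ (p ^ (n - 1)) := by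
  have h0 : GGS.zeroCons e ≠ 0 := by
    obtain ⟨i, hi⟩ := GGS.exists_zeroCons_ne_of_not_isSymmetric he
    intro h
    simp [h] at hi
  obtain ⟨β, hβ⟩ := GGS.exists_isDirectedExponent h0
  refine ⟨GGS.isContracting_ggsGroup e, ?_, fun n hn => ?_⟩
  · rw [GGS.portraitGrowth_ggsGroup h0, GGS.ball_zero, GGS.card_core hβ]
  · obtain ⟨n, rfl⟩ := Nat.exists_eq_add_of_le' hn
    rw [GGS.portraitGrowth_ggsGroup h0, GGS.card_ball_succ, GGS.card_stabBall_succ hp he hβ,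
      Nat.add_sub_cancel]
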